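/- Let $k,n\ge 1$ be integers and $\gamma,t\in(0,\infty)$. Let $\Theta$ be a $k\times n$ random matrix with i.i.d. Gaussian entries of mean zero and variance $1/n$, let $X$ be a random vector in $\mathbb{R}^n$ independent of $\Theta$, and let $N\sim\mathcal{N}(0,I_k)$ be independent of $(\Theta,X)$. Put $Y=\Theta X+\sqrt{t}\,N$. Let $P_{Y\mid\Theta}$ denote the conditional distribution of $Y$ given $\Theta$, let $G_Y$ denote the Gaussian distribution on $\mathbb{R}^k$ with the same mean and covariance as $Y$, and let $D(P\,\|\,Q)=\int\log\frac{dP}{dQ}\,dP$ denote relative entropy (natural logarithm, with value $+\infty$ if $P\not\ll Q$ or the integral does not exist). Let $$\beta_2(X)=\frac1n\left(\mathbb{E}\left[\langle X_1,X_2\rangle^2\right]\right)^{1/2},$$ where $X_1,X_2$ are independent with the same distribution as $X$. If $\frac1n\|X\|^2=\gamma$ almost surely (Euclidean norm), then $$\mathbb{E}\left[D(P_{Y\mid\Theta}\,\|\,G_Y)\right]\le k^{3/4}\left(\frac{\frac1n\|\mathbb{E}[X]\|^2}{\gamma}\right)^{1/2}+k^{1/4}\left(1+\frac{2\gamma}{t}\right)^{k/4}\frac{\beta_2(X)}{\gamma},$$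 where the expectation on the left is over $\Theta$. -/

import Mathlib

open MeasureTheory ProbabilityTheory InformationTheory
open scoped ENNReal NNReal Matrix

noncomputable section

/-- The product (entrywise Borel) sigma-algebra on real matrices. -/
instance matrixMeasurableSpace {k n : ℕ} : MeasurableSpace (Matrix (Fin k) (Fin n) ℝ) :=
  inferInstanceAs (MeasurableSpace (Fin k → Fin n → ℝ))

/-- `β_r(X) = (1/n) (E |⟨X₁, X₂⟩|^r)^(1/r)`, where `X₁, X₂` are independent with the same law as
the `n`-dimensional random vector `X`. -/
def betaFun {Ω : Type*} [MeasurableSpace Ω] {n : ℕ} (r : ℕ)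
    (X : Ω → EuclideanSpace ℝ (Fin n)) (P : Measure Ω) : ℝ :=
  (1 / (n : ℝ)) *
    (∫ p : EuclideanSpace ℝ (Fin n) × EuclideanSpace ℝ (Fin n),
      |inner ℝ p.1 p.2| ^ r ∂((P.map X).prod (P.map X))) ^ (1 / (r : ℝ))

/-- The entries of the `k × n` random matrix `Θ` are i.i.d. Gaussian with mean zero and
variance `1/n`. -/
structure IsIIDGaussianProjection {Ω : Type*} [MeasurableSpace Ω] {k n : ℕ}
    (Θ : Ω → Matrix (Fin k) (Fin n) ℝ) (P : Measure Ω) : Prop where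
  measurable : Measurable Θ
  iIndepFun_entries : iIndepFun (fun (ij : Fin k × Fin n) ω => Θ ω ij.1 ij.2) P
  map_entry : ∀ i j, P.map (fun ω => Θ ω i j) = gaussianReal 0 (1 / (n : ℝ≥0))

/-- The projection `Z = Θ X`. -/
def projZ {Ω : Type*} {k n : ℕ} (Θ : Ω → Matrix (Fin k) (Fin n) ℝ)
    (X : Ω → EuclideanSpace ℝ (Fin n)) : Ω → EuclideanSpace ℝ (Fin k) :=
  fun ω => WithLp.toLp 2 (Θ ω *ᵥ (X ω).ofLp)

/-- The noisy projection `Y = Θ X + √t N`. -/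
def projY {Ω : Type*} {k n : ℕ} (Θ : Ω → Matrix (Fin k) (Fin n) ℝ)
    (X : Ω → EuclideanSpace ℝ (Fin n)) (N : Ω → EuclideanSpace ℝ (Fin k)) (t : ℝ) :
    Ω → EuclideanSpace ℝ (Fin k) :=
  fun ω => projZ Θ X ω + √t • N ω

/-- The Gaussian distribution `G_Y` with the same mean and covariance as `Y`. -/
def gaussianApprox {Ω : Type*} [MeasurableSpace Ω] {k : ℕ}
    (Y : Ω → EuclideanSpace ℝ (Fin k)) (P : Measure Ω) : Measure (EuclideanSpace ℝ (Fin k)) :=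
  multivariateGaussian (∫ ω, Y ω ∂P)
    (Matrix.of fun i j => cov[fun ω => Y ω i, fun ω => Y ω j; P])

/-- `E[D(P_{Y|Θ} ‖ G)]`: the expectation over `Θ` of the relative entropy (natural logarithm)
between the regular conditional distribution of `Y` given `Θ` and `G`, valued in `[0, ∞]`. -/
def expectedCondKL {Ω α : Type*} [MeasurableSpace Ω] [MeasurableSpace α] {k : ℕ}
    (Y : Ω → EuclideanSpace ℝ (Fin k)) (Θ : Ω → α) (G : Measure (EuclideanSpace ℝ (Fin k)))
    (P : Measure Ω) [IsFiniteMeasure P] : ℝ≥0∞ :=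
  ∫⁻ ω, klDiv (condDistrib Y Θ P (Θ ω)) G ∂P

end

noncomputable section

/-! Write s = γ + t. On the sphere ΘX ~ N(0, γ I) whatever the direction of X, so Y is exactly N(0,
s I) and this is G_Y. Let r_θ(y) be the density of P_{Y|Θ=θ} with respect to G_Y: the average over X
of the likelihood ratio of N(θX, t I). For every fixed y one has E_Θ[r_Θ(y)] = 1. By Tonelli the
expected divergence is the G_Y-average over y of the entropy of Θ ↦ r_Θ(y), and for a density of
mean 1 the entropy is at most the log of the second moment (`lintegral_klFun_le_log`).

The second moment is computed with two independent copies X₁, X₂ of X. With ρ = ⟨X₁, X₂⟩/n, the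
vectors X₁ + X₂ and X₁ - X₂ are orthogonal because the norms agree, so their images under Θ are
independent Gaussians and the Θ-average is an explicit integral. It equals the product over
coordinates of Mehler's kernel on the diagonal, M(a) with a = ρ/s
(`lintegral_prod_gaussianRatio_mul`).

Mehler's formula expands M(a) as a power series in a whose coefficients are nonnegative (squares of
Hermite polynomials, multiplied out over coordinates) and which starts 1 + a|y|²/s. As |a| ≤ b :=
γ/s, all terms of order at least 2 together are at most (a/b)² M(b). Averaging over X₁, X₂ turns ρ
into |E X|²/n and ρ² into β₂², so the second moment at y is at most 1 + (|E X|²/(ns)) |y|²/s +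
(β₂²/γ²) M(b).

Finally log(1 + x + x') ≤ √x + √x', and integrating over y gives E√(|y|²/s) ≤ √k and E√M(b) =
((1+b)/(1-b))^{k/4} = (1 + 2γ/t)^{k/4}. -/

/-! ### Mehler's formula on the diagonal -/

/-- The normalized Hermite polynomials `He_j(u) / √(j!)`. -/
def normHermite (u : ℝ) : ℕ → ℝ
  | 0 => 1
  | 1 => u
  | (j + 2) => (u * normHermite u (j + 1) - √(j + 1 : ℝ) * normHermite u j) / √(j + 2 : ℝ)

/-- A recursively defined upper bound for `|normHermite u j|` of subexponential growth. -/
def hermiteBound (u : ℝ) : ℕ → ℝ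
  | 0 => 1
  | (j + 1) => (1 + |u| / √(j + 1 : ℝ)) * hermiteBound u j

lemma one_le_hermiteBound (u : ℝ) (j : ℕ) : 1 ≤ hermiteBound u j := by
  induction j with
  | zero => simp [hermiteBound]
  | succ j ih =>
    rw [hermiteBound]
    have : 0 ≤ |u| / √(j + 1 : ℝ) := by positivity
    nlinarith

lemma hermiteBound_le_succ (u : ℝ) (j : ℕ) : hermiteBound u j ≤ hermiteBound u (j + 1) := by
  rw [hermiteBound]
  have : 0 ≤ |u| / √(j + 1 : ℝ) := by positivity
  nlinarith [one_le_hermiteBound u j]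

lemma abs_normHermite_le (u : ℝ) (j : ℕ) :
    |normHermite u j| ≤ hermiteBound u j ∧ |normHermite u (j + 1)| ≤ hermiteBound u (j + 1) := by
  induction j with
  | zero => simp [normHermite, hermiteBound]
  | succ j ih =>
    refine ⟨ih.2, ?_⟩
    rw [normHermite, abs_div, abs_of_nonneg (Real.sqrt_nonneg _), div_le_iff₀ (by positivity)]
    have h1 : √(j + 1 : ℝ) ≤ √(j + 2 : ℝ) := Real.sqrt_le_sqrt (by linarith)
    have hM := hermiteBound_le_succ u j
    have hp : 0 < √(j + 2 : ℝ) := by positivity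
    have h0 := one_le_hermiteBound u j
    have e : hermiteBound u (j + 1 + 1) * √(j + 2 : ℝ)
        = (√(j + 2 : ℝ) + |u|) * hermiteBound u (j + 1) := by
      rw [hermiteBound.eq_def u (j + 1 + 1)]
      simp only
      push_cast
      rw [show (j : ℝ) + 1 + 1 = j + 2 by ring]
      field_simp
    rw [e]
    calc |u * normHermite u (j + 1) - √(j + 1 : ℝ) * normHermite u j|
        ≤ |u| * |normHermite u (j + 1)| + √(j + 1 : ℝ) * |normHermite u j| := by
          refine (abs_sub _ _).trans ?_
          rw [abs_mul, abs_mul, abs_of_nonneg (Real.sqrt_nonneg _)]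
      _ ≤ |u| * hermiteBound u (j + 1) + √(j + 2 : ℝ) * hermiteBound u (j + 1) := by
          gcongr
          · exact ih.2
          · exact ih.1.trans hM
      _ = _ := by ring

/-- The ratio test is run on the majorant `hermiteBound`, whose ratios tend to 1, because Hermite
values may vanish. The factor `j + 1` is what termwise differentiation of the Mehler series needs.
-/
lemma summable_succ_mul_normHermite_sq (u : ℝ) {r : ℝ} (hr0 : 0 ≤ r) (hr : r < 1) :
    Summable fun j : ℕ => (j + 1 : ℝ) * normHermite u j ^ 2 * r ^ j := by
  rcases hr0.eq_or_lt with rfl | hr0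
  · refine summable_of_ne_finset_zero (s := {0}) fun j hj => ?_
    simp at hj
    simp [hj]
  have hM : Summable fun j : ℕ => (j + 1 : ℝ) * hermiteBound u j ^ 2 * r ^ j := by
    refine summable_of_ratio_test_tendsto_lt_one hr (.of_forall fun j => ?_) ?_
    · have := one_le_hermiteBound u j
      positivity
    · have e : ∀ j : ℕ, ‖((j + 1 : ℕ) + 1 : ℝ) * hermiteBound u (j + 1) ^ 2 * r ^ (j + 1)‖ /
          ‖(j + 1 : ℝ) * hermiteBound u j ^ 2 * r ^ j‖
          = (1 + 1 / ((j : ℝ) + 1)) * (1 + |u| / √(j + 1 : ℝ)) ^ 2 * r := by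
        intro j
        have := one_le_hermiteBound u j
        have := one_le_hermiteBound u (j + 1)
        rw [Real.norm_of_nonneg (by positivity), Real.norm_of_nonneg (by positivity), hermiteBound]
        push_cast
        have : hermiteBound u j ≠ 0 := by linarith
        field_simp
        ring
      simp_rw [e]
      have t1 : Filter.Tendsto (fun j : ℕ => 1 / ((j : ℝ) + 1)) Filter.atTop (nhds 0) :=
        tendsto_one_div_add_atTop_nhds_zero_nat
      have t2 : Filter.Tendsto (fun j : ℕ => |u| / √(j + 1 : ℝ)) Filter.atTop (nhds 0) := by
        refine Filter.Tendsto.div_atTop tendsto_const_nhds ?_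
        exact Real.tendsto_sqrt_atTop.comp
          (Filter.tendsto_atTop_add_const_right _ _ tendsto_natCast_atTop_atTop)
      simpa using ((t1.const_add 1).mul ((t2.const_add 1).pow 2)).mul_const r
  refine Summable.of_nonneg_of_le (fun j => by positivity) (fun j => ?_) hM
  have := (abs_normHermite_le u j).1
  have h2 : normHermite u j ^ 2 ≤ hermiteBound u j ^ 2 := by
    rw [← sq_abs]; gcongr
  gcongr

/-- The three-term recurrence at two consecutive indices, each squared after isolating its outer
term, produces the same cross term. Subtracting removes it and leaves a linear recurrence for the
squares alone. -/
lemma succ_mul_normHermite_sq (u : ℝ) (j : ℕ) :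
    (j + 3 : ℝ) * normHermite u (j + 3) ^ 2 = (u ^ 2 - (j + 2)) * normHermite u (j + 2) ^ 2 +
      (j + 2 - u ^ 2) * normHermite u (j + 1) ^ 2 + (j + 1) * normHermite u j ^ 2 := by
  have h3 : √(j + 3 : ℝ) * normHermite u (j + 3)
      = u * normHermite u (j + 2) - √(j + 2 : ℝ) * normHermite u (j + 1) := by
    rw [normHermite.eq_def u (j + 3)]
    simp only
    push_cast
    rw [show (j : ℝ) + 1 + 2 = j + 3 by ring, show (j : ℝ) + 1 + 1 = j + 2 by ring]
    field_simp
  have h2 : √(j + 2 : ℝ) * normHermite u (j + 2)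
      = u * normHermite u (j + 1) - √(j + 1 : ℝ) * normHermite u j := by
    rw [normHermite.eq_def u (j + 2)]
    simp only
    field_simp
  have e1 : √(j + 1 : ℝ) ^ 2 = j + 1 := Real.sq_sqrt (by positivity)
  have e2 : √(j + 2 : ℝ) ^ 2 = j + 2 := Real.sq_sqrt (by positivity)
  have e3 : √(j + 3 : ℝ) ^ 2 = j + 3 := Real.sq_sqrt (by positivity)
  have k3 := congrArg (· ^ 2) h3
  have k2 := congrArg (· ^ 2) (show √(j + 1 : ℝ) * normHermite u j
    = u * normHermite u (j + 1) - √(j + 2 : ℝ) * normHermite u (j + 2) by linarith)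
  simp only [mul_pow, sub_sq, e1, e2, e3] at k3 k2
  linear_combination k3 - k2

/-- Mehler's formula on the diagonal. -/
lemma hasSum_mehler (u : ℝ) {a : ℝ} (ha : |a| < 1) :
    HasSum (fun j : ℕ => normHermite u j ^ 2 * a ^ j)
      ((√(1 - a ^ 2))⁻¹ * Real.exp (u ^ 2 * (a / (1 + a)))) := by
  set c : ℕ → ℝ := fun j => normHermite u j ^ 2 with hc
  have sum1 : ∀ x : ℝ, |x| < 1 → Summable fun j : ℕ => (j + 1 : ℝ) * c j * |x| ^ j := fun x hx =>
    summable_succ_mul_normHermite_sq u (abs_nonneg x) hx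
  have S1 : ∀ x : ℝ, |x| < 1 → Summable fun j : ℕ => (j : ℝ) * c j * x ^ j := fun x hx => by
    refine Summable.of_norm_bounded (sum1 x hx) fun j => ?_
    rw [norm_mul, norm_pow, Real.norm_eq_abs x, Real.norm_of_nonneg (by positivity)]
    gcongr; linarith
  have S0 : ∀ x : ℝ, |x| < 1 → Summable fun j : ℕ => c j * x ^ j := fun x hx => by
    refine Summable.of_norm_bounded (sum1 x hx) fun j => ?_
    rw [norm_mul, norm_pow x, Real.norm_eq_abs x, Real.norm_of_nonneg (by positivity)]
    gcongr
    have : (0 : ℝ) ≤ j * c j := by positivity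
    linarith
  have Sd : ∀ x : ℝ, |x| < 1 → Summable fun j : ℕ => (j : ℝ) * c j * x ^ (j - 1) := fun x hx => by
    by_cases hx0 : x = 0
    · refine summable_of_ne_finset_zero (s := {1}) fun j hj => ?_
      rcases j with _ | _ | j <;> simp_all
    · refine (S1 x hx).mul_right x⁻¹ |>.congr fun j => ?_
      rcases j with _ | j
      · simp
      · simp only [pow_succ, Nat.add_sub_cancel]; field_simp
  set F : ℝ → ℝ := fun x => ∑' j : ℕ, c j * x ^ j with hF
  set D : ℝ → ℝ := fun x => ∑' j : ℕ, (j : ℝ) * c j * x ^ (j - 1) with hD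
  -- Termwise differentiation on a ball of radius `r` with `|x| < r < 1`, where the derivative
  -- series at `r` is a uniform majorant.
  have hder : ∀ x : ℝ, |x| < 1 → HasDerivAt F (D x) x := fun x hx => by
    obtain ⟨r, hxr, hr1⟩ := exists_between hx
    have hr0 : 0 ≤ r := (abs_nonneg x).trans hxr.le
    refine hasDerivAt_tsum_of_isPreconnected (t := Metric.ball (0 : ℝ) r) (y₀ := x)
      (g := fun j y => c j * y ^ j) (g' := fun j y => (j : ℝ) * c j * y ^ (j - 1))
      (Sd r (by rwa [abs_of_nonneg hr0])) Metric.isOpen_ball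
      (convex_ball _ _).isPreconnected (fun j y hy => ?_) (fun j y hy => ?_) ?_ (S0 x hx) ?_
    · exact ((hasDerivAt_pow j y).const_mul (c j)).congr_deriv (by ring)
    · rw [norm_mul, norm_pow, Real.norm_of_nonneg (by positivity)]
      have : ‖y‖ ≤ r := by simpa using (Metric.mem_ball.1 hy).le
      gcongr
    · simpa using hxr
    · simpa using hxr
  -- The recurrence for the squares becomes a first-order linear differential equation for the
  -- generating function. It starts at index 3, so coefficients 0, 1, 2 are peeled off by hand.
  have hode : ∀ x : ℝ, |x| < 1 →
      (1 - x) * (1 + x) ^ 2 * D x = (u ^ 2 + (1 - u ^ 2) * x + x ^ 2) * F x := fun x hx => by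
    have T0 := S0 x hx
    have D0 := Sd x hx
    have c0 : c 0 = 1 := by simp [hc, normHermite]
    have c1 : c 1 = u ^ 2 := by simp [hc, normHermite]
    have c2 : 2 * c 2 = (u ^ 2 - 1) ^ 2 := by
      simp only [hc, normHermite, div_pow]
      norm_num
      ring
    have tT : Summable fun j : ℕ => c (j + 1) * x ^ j := by
      by_cases hx0 : x = 0
      · refine summable_of_ne_finset_zero (s := {0}) fun j hj => ?_
        simp at hj; simp [hj, hx0]
      · refine (((summable_nat_add_iff 1).2 T0).mul_right x⁻¹).congr fun j => ?_
        simp only [pow_succ]; field_simp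
    have tT2 : Summable fun j : ℕ => c (j + 2) * x ^ j := by
      by_cases hx0 : x = 0
      · refine summable_of_ne_finset_zero (s := {0}) fun j hj => ?_
        simp at hj; simp [hj, hx0]
      · refine (((summable_nat_add_iff 1).2 tT).mul_right x⁻¹).congr fun j => ?_
        simp only [pow_succ]; field_simp
    have dD : Summable fun j : ℕ => ((j : ℝ) + 1) * c (j + 1) * x ^ j := by
      refine ((summable_nat_add_iff 1).2 D0).congr fun j => ?_
      simp
    have dD1 : Summable fun j : ℕ => ((j : ℝ) + 2) * c (j + 2) * x ^ j := by
      by_cases hx0 : x = 0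
      · refine summable_of_ne_finset_zero (s := {0}) fun j hj => ?_
        simp at hj; simp [hj, hx0]
      · refine (((summable_nat_add_iff 1).2 dD).mul_right x⁻¹).congr fun j => ?_
        simp only [pow_succ]; push_cast; field_simp; ring
    have E0 : F x = c 0 + x * ∑' j : ℕ, c (j + 1) * x ^ j := by
      rw [hF]; simp only
      rw [T0.tsum_eq_zero_add, ← tsum_mul_left]
      congr 1
      · simp
      · exact tsum_congr fun j => by ring
    have E1 : ∑' j : ℕ, c (j + 1) * x ^ j = c 1 + x * ∑' j : ℕ, c (j + 2) * x ^ j := by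
      rw [tT.tsum_eq_zero_add, ← tsum_mul_left]
      congr 1
      · simp
      · exact tsum_congr fun j => by ring_nf
    have G0 : D x = ∑' j : ℕ, ((j : ℝ) + 1) * c (j + 1) * x ^ j := by
      rw [hD]; simp only
      rw [D0.tsum_eq_zero_add]
      simp
    have G1 : ∑' j : ℕ, ((j : ℝ) + 1) * c (j + 1) * x ^ j
        = c 1 + x * ∑' j : ℕ, ((j : ℝ) + 2) * c (j + 2) * x ^ j := by
      rw [dD.tsum_eq_zero_add, ← tsum_mul_left]
      congr 1
      · simp
      · exact tsum_congr fun j => by push_cast; ring_nf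
    have G2 : ∑' j : ℕ, ((j : ℝ) + 2) * c (j + 2) * x ^ j
        = 2 * c 2 + x * ∑' j : ℕ, ((j : ℝ) + 3) * c (j + 3) * x ^ j := by
      rw [dD1.tsum_eq_zero_add, ← tsum_mul_left]
      congr 1
      · simp
      · exact tsum_congr fun j => by push_cast; ring_nf
    have xD : HasSum (fun j : ℕ => (j : ℝ) * c j * x ^ j) (x * D x) := by
      refine (D0.hasSum.mul_left x).congr_fun ?_
      intro j
      rcases j with _ | j
      · simp
      · simp only [pow_succ, Nat.add_sub_cancel]; ring
    have R : ∑' j : ℕ, ((j : ℝ) + 3) * c (j + 3) * x ^ j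
        = u ^ 2 * (∑' j : ℕ, c (j + 2) * x ^ j) - (∑' j : ℕ, ((j : ℝ) + 2) * c (j + 2) * x ^ j)
          + (∑' j : ℕ, ((j : ℝ) + 1) * c (j + 1) * x ^ j)
          + (1 - u ^ 2) * (∑' j : ℕ, c (j + 1) * x ^ j) + x * D x + F x := by
      refine HasSum.tsum_eq ?_
      have := (((((tT2.hasSum.mul_left (u ^ 2)).sub dD1.hasSum).add dD.hasSum).add
        (tT.hasSum.mul_left (1 - u ^ 2))).add xD).add T0.hasSum
      refine this.congr_fun ?_
      intro j
      have := succ_mul_normHermite_sq u j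
      simp only [hc]
      linear_combination x ^ j * this
    rw [c0] at E0
    rw [c1] at E1 G1
    rw [c2] at G2
    rw [← G0] at G1 R
    linear_combination x ^ 2 * R + (1 + x) * G1 + x * G2 - u ^ 2 * (E0 + x * E1)
      - (1 - u ^ 2) * x * E0
  -- `Q` is the reciprocal of the claimed closed form; showing that `F * Q` is constant replaces a
  -- uniqueness theorem for the equation.
  set Q : ℝ → ℝ := fun x => √(1 - x ^ 2) * Real.exp (-(u ^ 2 * (x / (1 + x)))) with hQ
  have hQder : ∀ x : ℝ, |x| < 1 →
      HasDerivAt Q (Q x * (-x / (1 - x ^ 2) - u ^ 2 / (1 + x) ^ 2)) x := fun x hx => by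
    have hx1 : 0 < 1 + x := by linarith [(abs_lt.1 hx).1]
    have hx2 : 0 < 1 - x ^ 2 := by nlinarith [(abs_lt.1 hx).1, (abs_lt.1 hx).2]
    have d1 : HasDerivAt (fun x : ℝ => √(1 - x ^ 2)) ((-(2 * x)) / (2 * √(1 - x ^ 2))) x := by
      refine HasDerivAt.sqrt ?_ hx2.ne'
      simpa using (hasDerivAt_pow 2 x).const_sub 1
    have d2 : HasDerivAt (fun x : ℝ => x / (1 + x)) (1 / (1 + x) ^ 2) x := by
      refine ((hasDerivAt_id' x).div ((hasDerivAt_id' x).const_add 1) hx1.ne').congr_deriv ?_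
      ring
    refine (d1.mul ((d2.const_mul (u ^ 2)).neg.exp)).congr_deriv ?_
    simp only [hQ, Pi.neg_apply]
    have hs : √(1 - x ^ 2) ^ 2 = 1 - x ^ 2 := Real.sq_sqrt hx2.le
    have hs0 : √(1 - x ^ 2) ≠ 0 := by positivity
    generalize √(1 - x ^ 2) = w at hs hs0
    rw [← hs]
    field_simp
    ring
  have hconst : ∀ x ∈ Metric.ball (0 : ℝ) 1, HasDerivAt (fun x => F x * Q x) 0 x := fun x hx => by
    have hx : |x| < 1 := by simpa using hx
    have hx1 : 0 < 1 + x := by linarith [(abs_lt.1 hx).1]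
    have hx1' : 0 < 1 - x := by linarith [(abs_lt.1 hx).2]
    refine ((hder x hx).mul (hQder x hx)).congr_deriv ?_
    have := hode x hx
    have e : D x = F x * (x / (1 - x ^ 2) + u ^ 2 / (1 + x) ^ 2) := by
      rw [show 1 - x ^ 2 = (1 - x) * (1 + x) by ring]
      field_simp
      linear_combination this
    rw [e]; ring
  have key : F a * Q a = F 0 * Q 0 := by
    refine Metric.isOpen_ball.is_const_of_deriv_eq_zero (convex_ball (0 : ℝ) 1).isPreconnected
      (fun x hx => (hconst x hx).differentiableAt.differentiableWithinAt)
      (fun x hx => (hconst x hx).deriv) (by simpa using ha) (by simp)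
  have hF0 : F 0 = 1 := by
    simp only [hF]
    rw [tsum_eq_single 0 (fun j hj => by simp [hj])]
    simp [hc, normHermite]
  have hQ0 : Q 0 = 1 := by simp [hQ]
  have hFa : F a = (√(1 - a ^ 2))⁻¹ * Real.exp (u ^ 2 * (a / (1 + a))) := by
    have ha2 : 0 < 1 - a ^ 2 := by nlinarith [(abs_lt.1 ha).1, (abs_lt.1 ha).2]
    have hs0 : √(1 - a ^ 2) ≠ 0 := by positivity
    rw [hF0, hQ0, hQ] at key
    simp only [Real.exp_neg] at key
    field_simp at key ⊢
    linarith
  rw [← hFa]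
  exact (S0 a ha).hasSum

/-! ### Power series with nonnegative coefficients -/

/-- A function on `(-1, 1)` which is a power series with nonnegative coefficients, the first two of
which are `1` and `z`. -/
def HasNonnegSeries (F : ℝ → ℝ) (z : ℝ) : Prop :=
  ∃ c : ℕ → ℝ, (∀ j, 0 ≤ c j) ∧ c 0 = 1 ∧ c 1 = z ∧
    ∀ a : ℝ, |a| < 1 → HasSum (fun j => c j * a ^ j) (F a)

lemma HasNonnegSeries.one : HasNonnegSeries (fun _ => 1) 0 := by
  refine ⟨fun j => if j = 0 then 1 else 0, fun j => by positivity, by simp, by simp, fun a _ => ?_⟩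
  convert hasSum_ite_eq 0 (1 : ℝ) using 2 with j
  split_ifs with h <;> simp [h]

/-- Cauchy product. Since both constant terms are 1, the linear coefficients add, which is how the
sum over coordinates enters. -/
lemma HasNonnegSeries.mul {F G : ℝ → ℝ} {z w : ℝ} (hF : HasNonnegSeries F z)
    (hG : HasNonnegSeries G w) : HasNonnegSeries (fun a => F a * G a) (z + w) := by
  obtain ⟨c, c_nonneg, c0, c1, hc⟩ := hF
  obtain ⟨d, d_nonneg, d0, d1, hd⟩ := hG
  refine ⟨fun j => ∑ p ∈ Finset.HasAntidiagonal.antidiagonal j, c p.1 * d p.2,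
    fun j => ?_, ?_, ?_, fun a ha => ?_⟩
  · exact Finset.sum_nonneg fun p _ => mul_nonneg (c_nonneg _) (d_nonneg _)
  · simp [c0, d0]
  · simp [Finset.Nat.antidiagonal_succ, c0, d0, c1, d1]; ring
  · have nc : Summable fun j => ‖c j * a ^ j‖ := (hc a ha).summable.norm
    have nd : Summable fun j => ‖d j * a ^ j‖ := (hd a ha).summable.norm
    have e : ∀ j, (∑ p ∈ Finset.HasAntidiagonal.antidiagonal j, c p.1 * d p.2) * a ^ j
        = ∑ p ∈ Finset.HasAntidiagonal.antidiagonal j, c p.1 * a ^ p.1 * (d p.2 * a ^ p.2) := fun j => by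
      rw [Finset.sum_mul]
      refine Finset.sum_congr rfl fun p hp => ?_
      rw [← Finset.HasAntidiagonal.mem_antidiagonal.1 hp, pow_add]; ring
    simp_rw [e]
    rw [← (hc a ha).tsum_eq, ← (hd a ha).tsum_eq,
      tsum_mul_tsum_eq_tsum_sum_antidiagonal_of_summable_norm nc nd]
    exact (summable_norm_sum_mul_antidiagonal_of_summable_norm nc nd).of_norm.hasSum

lemma HasNonnegSeries.prod {ι : Type*} (s : Finset ι) {F : ι → ℝ → ℝ} {z : ι → ℝ}
    (h : ∀ i ∈ s, HasNonnegSeries (F i) (z i)) :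
    HasNonnegSeries (fun a => ∏ i ∈ s, F i a) (∑ i ∈ s, z i) := by
  classical
  induction s using Finset.induction_on with
  | empty => simpa using HasNonnegSeries.one
  | insert i s hi ih =>
    simp_rw [Finset.prod_insert hi, Finset.sum_insert hi]
    exact (h i (by simp)).mul (ih fun j hj => h j (by simp [hj]))

/-- From order 2 on, `a ^ (j + 2) ≤ a ^ 2 / b ^ 2 * b ^ (j + 2)`, and nonnegative coefficients
preserve this. The linear term is kept exactly, sign included, so that it can later be averaged over
the pair of copies of X. -/
lemma HasNonnegSeries.le {F : ℝ → ℝ} {z : ℝ} (h : HasNonnegSeries F z) {a b : ℝ} (hab : |a| ≤ b)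
    (hb0 : 0 < b) (hb : b < 1) : F a ≤ 1 + a * z + a ^ 2 / b ^ 2 * F b := by
  obtain ⟨c, c_nonneg, c0, c1, hc⟩ := h
  have ha := hc a (hab.trans_lt hb)
  have hb' := hc b (by rwa [abs_of_pos hb0])
  have h2a := (hasSum_nat_add_iff' 2).2 ha
  have h2b := (hasSum_nat_add_iff' 2).2 hb'
  simp only [Finset.sum_range_succ, Finset.sum_range_zero, c0, c1] at h2a h2b
  have := hasSum_le (fun j => ?_) h2a (h2b.mul_left (a ^ 2 / b ^ 2))
  · have hz : 0 ≤ z := c1 ▸ c_nonneg 1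
    have : 0 ≤ a ^ 2 / b ^ 2 * (1 + z * b) := by positivity
    nlinarith
  · have h1 : a ^ j ≤ b ^ j := (le_abs_self _).trans (by rw [abs_pow]; gcongr)
    calc c (j + 2) * a ^ (j + 2) = a ^ 2 * (c (j + 2) * a ^ j) := by ring
      _ ≤ a ^ 2 * (c (j + 2) * b ^ j) := by have := c_nonneg (j + 2); gcongr
      _ = _ := by field_simp; try ring

/-- The diagonal of the one-dimensional Mehler kernel, as a function of the correlation `a` and the
squared argument. -/
def mehlerDiag (z a : ℝ) : ℝ := (√(1 - a ^ 2))⁻¹ * Real.exp (z * (a / (1 + a)))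

lemma hasNonnegSeries_mehlerDiag {z : ℝ} (hz : 0 ≤ z) : HasNonnegSeries (mehlerDiag z) z := by
  refine ⟨fun j => normHermite (√z) j ^ 2, fun j => sq_nonneg _, by simp [normHermite],
    by simp [normHermite, Real.sq_sqrt hz], fun a ha => ?_⟩
  have := hasSum_mehler (√z) ha
  rwa [Real.sq_sqrt hz] at this

lemma prod_mehlerDiag_le {ι : Type*} [Fintype ι] {z : ι → ℝ} (hz : ∀ i, 0 ≤ z i) {a b : ℝ}
    (hab : |a| ≤ b) (hb0 : 0 < b) (hb : b < 1) :
    ∏ i, mehlerDiag (z i) a ≤ 1 + a * ∑ i, z i + a ^ 2 / b ^ 2 * ∏ i, mehlerDiag (z i) b :=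
  (HasNonnegSeries.prod Finset.univ fun i _ => hasNonnegSeries_mehlerDiag (hz i)).le hab hb0 hb

/-! ### Gaussian integrals and likelihood ratios -/

/-- Completing the square: the weighted density is a constant times that of a Gaussian with variance
`w = v / (1 - 2αv)` and mean `βw`. Variance zero is included since X₁ = ±X₂ does occur. -/
lemma lintegral_exp_quadratic_gaussianReal (v : ℝ≥0) (α β : ℝ) (h : 2 * α * v < 1) :
    ∫⁻ x, ENNReal.ofReal (Real.exp (α * x ^ 2 + β * x)) ∂(gaussianReal 0 v) =
      ENNReal.ofReal ((√(1 - 2 * α * v))⁻¹ *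
        Real.exp (β ^ 2 * v / (2 * (1 - 2 * α * v)))) := by
  rcases eq_or_ne v 0 with rfl | hv
  · simp [gaussianReal_zero_var]
  have hv0 : (0 : ℝ) < v := by positivity
  have hd : 0 < 1 - 2 * α * v := by linarith
  set w : ℝ≥0 := v / (1 - 2 * α * v).toNNReal with hw
  have hwr : (w : ℝ) = v / (1 - 2 * α * v) := by
    rw [hw, NNReal.coe_div, Real.coe_toNNReal _ hd.le]
  have hw0 : w ≠ 0 := by
    rw [← NNReal.coe_ne_zero, hwr]; positivity
  rw [gaussianReal_of_var_ne_zero _ hv,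
    lintegral_withDensity_eq_lintegral_mul _ (measurable_gaussianPDF 0 v) (by fun_prop)]
  have e : ∀ x, (gaussianPDF 0 v * fun x => ENNReal.ofReal (Real.exp (α * x ^ 2 + β * x))) x =
      ENNReal.ofReal ((√(1 - 2 * α * v))⁻¹ *
        Real.exp (β ^ 2 * v / (2 * (1 - 2 * α * v)))) * gaussianPDF (β * w) w x := fun x => by
    rw [Pi.mul_apply, gaussianPDF, gaussianPDF, ← ENNReal.ofReal_mul (gaussianPDFReal_nonneg _ _ _),
      ← ENNReal.ofReal_mul (by positivity), gaussianPDFReal, gaussianPDFReal, hwr]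
    congr 1
    have e1 : √(2 * Real.pi * (v / (1 - 2 * α * v)))
        = √(2 * Real.pi * v) / √(1 - 2 * α * v) := by
      rw [← Real.sqrt_div (by positivity)]; congr 1; ring
    rw [e1]
    have : √(1 - 2 * α * v) ≠ 0 := by positivity
    have e2 : (√(1 - 2 * α * v))⁻¹ * Real.exp (β ^ 2 * v / (2 * (1 - 2 * α * v))) *
        ((√(2 * Real.pi * v) / √(1 - 2 * α * v))⁻¹ *
          Real.exp (-(x - β * (v / (1 - 2 * α * v))) ^ 2 / (2 * (v / (1 - 2 * α * v)))))
        = (√(2 * Real.pi * v))⁻¹ * (Real.exp (β ^ 2 * v / (2 * (1 - 2 * α * v))) *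
          Real.exp (-(x - β * (v / (1 - 2 * α * v))) ^ 2 / (2 * (v / (1 - 2 * α * v))))) := by
      field_simp
    rw [e2, mul_assoc, ← Real.exp_add, ← Real.exp_add]
    congr 2
    obtain ⟨d, hde⟩ : ∃ d, 1 - 2 * α * v = d := ⟨_, rfl⟩
    have hα : α = (1 - d) / (2 * v) := by field_simp; linarith
    have hd' : 0 < d := hde ▸ hd
    rw [hde, hα]
    field_simp
    ring
  simp_rw [e]
  rw [lintegral_const_mul _ (measurable_gaussianPDF _ _), lintegral_gaussianPDF_eq_one _ hw0,
    mul_one]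

/-- The likelihood ratio at `y` of the real Gaussian with mean `m` and variance `t` with respect to
the centred Gaussian with variance `s`. -/
def gaussianRatio (t s : ℝ) (m y : ℝ) : ℝ≥0∞ :=
  ENNReal.ofReal (√(s / t) * Real.exp (-(y - m) ^ 2 / (2 * t) + y ^ 2 / (2 * s)))

@[fun_prop]
lemma measurable_gaussianRatio {α : Type*} [MeasurableSpace α] (t s : ℝ) {f g : α → ℝ}
    (hf : Measurable f) (hg : Measurable g) : Measurable fun x => gaussianRatio t s (f x) (g x) := by
  unfold gaussianRatio; fun_prop

lemma gaussianReal_eq_withDensity {t s : ℝ≥0} (ht : t ≠ 0) (hs : s ≠ 0) (m : ℝ) :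
    gaussianReal m t = (gaussianReal 0 s).withDensity (gaussianRatio t s m) := by
  have hm : Measurable (gaussianRatio t s m) := by fun_prop
  rw [gaussianReal_of_var_ne_zero _ ht, gaussianReal_of_var_ne_zero _ hs,
    ← withDensity_mul _ (measurable_gaussianPDF _ _) hm]
  congr 1
  ext x
  rw [Pi.mul_apply, gaussianPDF, gaussianPDF, gaussianRatio,
    ← ENNReal.ofReal_mul (gaussianPDFReal_nonneg _ _ _), gaussianPDFReal, gaussianPDFReal]
  congr 1
  have ht0 : (0 : ℝ) < t := by positivity
  have hs0 : (0 : ℝ) < s := by positivity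
  rw [Real.sqrt_div hs0.le, Real.sqrt_mul (by positivity) (s : ℝ),
    Real.sqrt_mul (by positivity) (t : ℝ), Real.exp_add, sub_zero,
    show (-x ^ 2 / (2 * s) : ℝ) = -(x ^ 2 / (2 * s)) by ring, Real.exp_neg]
  have := Real.exp_pos (x ^ 2 / (2 * s))
  field_simp

lemma lintegral_prod_pi {ι : Type*} [Fintype ι] {Ω : ι → Type*} [∀ i, MeasurableSpace (Ω i)]
    (μ : ∀ i, Measure (Ω i)) [∀ i, IsProbabilityMeasure (μ i)] {f : ∀ i, Ω i → ℝ≥0∞}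
    (hf : ∀ i, Measurable (f i)) :
    ∫⁻ x, ∏ i, f i (x i) ∂(Measure.pi μ) = ∏ i, ∫⁻ x, f i x ∂(μ i) := by
  rw [lintegral_prod_eq_prod_lintegral_of_indepFun Finset.univ
    (fun i (x : ∀ i, Ω i) => f i (x i)) (iIndepFun_pi fun i => (hf i).aemeasurable)
    (fun i => (hf i).comp (measurable_pi_apply i))]
  refine Finset.prod_congr rfl fun i _ => ?_
  exact (measurePreserving_eval μ i).lintegral_comp (hf i)

lemma pi_withDensity {ι : Type*} [Fintype ι] {Ω : ι → Type*} [∀ i, MeasurableSpace (Ω i)]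
    (μ : ∀ i, Measure (Ω i)) [∀ i, IsProbabilityMeasure (μ i)] {f : ∀ i, Ω i → ℝ≥0∞}
    (hf : ∀ i, Measurable (f i)) [∀ i, SigmaFinite ((μ i).withDensity (f i))] :
    Measure.pi (fun i => (μ i).withDensity (f i))
      = (Measure.pi μ).withDensity (fun x => ∏ i, f i (x i)) := by
  refine (Measure.pi_eq (μ := fun i => (μ i).withDensity (f i)) fun s hs => ?_)
  rw [withDensity_apply _ (MeasurableSet.univ_pi hs), ← lintegral_indicator (MeasurableSet.univ_pi hs)]
  have : ∀ x, (Set.univ.pi s).indicator (fun x => ∏ i, f i (x i)) x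
      = ∏ i, (s i).indicator (f i) (x i) := fun x => by
    by_cases hx : x ∈ Set.univ.pi s
    · rw [Set.indicator_of_mem hx]
      exact Finset.prod_congr rfl fun i _ => (Set.indicator_of_mem (hx i trivial) _).symm
    · rw [Set.indicator_of_notMem hx]
      simp only [Set.mem_univ_pi, not_forall] at hx
      obtain ⟨i, hi⟩ := hx
      exact (Finset.prod_eq_zero (Finset.mem_univ i) (Set.indicator_of_notMem hi _)).symm
  simp_rw [this]
  rw [lintegral_prod_pi μ fun i => (hf i).indicator (hs i)]
  refine Finset.prod_congr rfl fun i _ => ?_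
  rw [lintegral_indicator (hs i), withDensity_apply _ (hs i)]

/-- The Gaussian measure on `ℝᵏ` with mean zero and covariance `s • 1`. -/
def isoGaussian (k : ℕ) (s : ℝ≥0) : Measure (EuclideanSpace ℝ (Fin k)) :=
  (Measure.pi fun _ : Fin k => gaussianReal 0 s).map (WithLp.toLp 2)

instance (k : ℕ) (s : ℝ≥0) : IsProbabilityMeasure (isoGaussian k s) :=
  Measure.isProbabilityMeasure_map (by fun_prop)

lemma posSemidef_smul_one (k : ℕ) (s : ℝ≥0) :
    ((s : ℝ) • (1 : Matrix (Fin k) (Fin k) ℝ)).PosSemidef :=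
  Matrix.PosSemidef.one.smul s.2

lemma multivariateGaussian_smul_one (k : ℕ) (s : ℝ≥0) :
    multivariateGaussian 0 ((s : ℝ) • (1 : Matrix (Fin k) (Fin k) ℝ)) = isoGaussian k s := by
  apply Measure.ext_of_charFun
  ext x
  rw [charFun_multivariateGaussian (posSemidef_smul_one k s), isoGaussian, charFun_pi]
  simp_rw [charFun_gaussianReal, ← Complex.exp_sum]
  simp [Matrix.smul_mulVec, dotProduct, Finset.sum_div]
  congr 2
  exact Finset.sum_congr rfl fun i _ => by ring

/-- Change of measure: coordinatewise, N(m, t) is absolutely continuous with respect to N(0, s), and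
the densities multiply. -/
lemma lintegral_stdGaussian_add {k : ℕ} {t s : ℝ≥0} (ht : t ≠ 0) (hs : s ≠ 0)
    (m : EuclideanSpace ℝ (Fin k)) {f : EuclideanSpace ℝ (Fin k) → ℝ≥0∞} (hf : Measurable f) :
    ∫⁻ x, f (m + √(t : ℝ) • x) ∂(stdGaussian (EuclideanSpace ℝ (Fin k)))
      = ∫⁻ y, (∏ i, gaussianRatio t s (m i) (y i)) * f y ∂(isoGaussian k s) := by
  have hr : ∀ i, Measurable (gaussianRatio t s (m i)) := fun i =>
    measurable_gaussianRatio _ _ (by fun_prop) (by fun_prop)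
  have hpi : (Measure.pi fun _ : Fin k => gaussianReal 0 1).map
        (fun x i => m i + √(t : ℝ) * x i)
      = (Measure.pi fun _ : Fin k => gaussianReal 0 s).withDensity
        (fun y => ∏ i, gaussianRatio t s (m i) (y i)) := by
    have : ∀ i : Fin k, (gaussianReal 0 s).withDensity (gaussianRatio t s (m i))
        = gaussianReal (m i) t := fun i => (gaussianReal_eq_withDensity ht hs _).symm
    have inst : ∀ i : Fin k,
        SigmaFinite ((gaussianReal 0 s).withDensity (gaussianRatio t s (m i))) := fun i => by
      rw [this]; infer_instance
    rw [← pi_withDensity _ hr]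
    simp_rw [this]
    have e : ∀ i : Fin k, (gaussianReal 0 1).map (fun x => m i + √(t : ℝ) * x)
        = gaussianReal (m i) t := fun i => by
      have : (fun x => m i + √(t : ℝ) * x) = (m i + ·) ∘ (√(t : ℝ) * ·) := rfl
      rw [this, ← Measure.map_map (by fun_prop) (by fun_prop), gaussianReal_map_const_mul,
        gaussianReal_map_const_add]
      congr 1
      · simp
      · ext; simp
    have := Measure.pi_map_pi (μ := fun _ : Fin k => gaussianReal 0 1)
      (f := fun i x => m i + √(t : ℝ) * x) (hμ := fun i => by rw [e]; infer_instance)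
      (fun i => by fun_prop)
    rw [this]
    simp_rw [e]
  have hm : Measurable fun y : Fin k → ℝ => ∏ i, gaussianRatio t s (m i) (y i) := by fun_prop
  rw [← map_pi_eq_stdGaussian, lintegral_map (by fun_prop) (by fun_prop), isoGaussian,
    lintegral_map (by fun_prop) (by fun_prop)]
  have h1 : ∫⁻ x, f (WithLp.toLp 2 x) ∂((Measure.pi fun _ : Fin k => gaussianReal 0 1).map
        (fun x i => m i + √(t : ℝ) * x i))
      = ∫⁻ x, f (m + √(t : ℝ) • WithLp.toLp 2 x) ∂(Measure.pi fun _ : Fin k => gaussianReal 0 1) := by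
    rw [lintegral_map (by fun_prop) (by fun_prop)]
    rfl
  rw [← h1, hpi, lintegral_withDensity_eq_lintegral_mul _ hm (by fun_prop)]
  rfl

/-! ### Linear images of the Gaussian matrix -/

namespace IsIIDGaussianProjection

variable {Ω : Type*} [MeasurableSpace Ω] {P : Measure Ω} {k n : ℕ}
  {Θ : Ω → Matrix (Fin k) (Fin n) ℝ}

lemma measurable_entry (hΘ : IsIIDGaussianProjection Θ P) (i : Fin k) (j : Fin n) :
    Measurable fun ω => Θ ω i j :=
  (measurable_pi_apply j).comp ((measurable_pi_apply i).comp hΘ.measurable)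

lemma hasGaussianLaw_entry (hΘ : IsIIDGaussianProjection Θ P) (i : Fin k) (j : Fin n) :
    HasGaussianLaw (fun ω => Θ ω i j) P :=
  ⟨by rw [hΘ.map_entry]; infer_instance⟩

lemma hasGaussianLaw_entries (hΘ : IsIIDGaussianProjection Θ P) :
    HasGaussianLaw (fun ω (ij : Fin k × Fin n) => Θ ω ij.1 ij.2) P :=
  iIndepFun.hasGaussianLaw (X := fun (ij : Fin k × Fin n) ω => Θ ω ij.1 ij.2)
    (fun ij => hΘ.hasGaussianLaw_entry ij.1 ij.2) hΘ.iIndepFun_entries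

lemma integral_entry (hΘ : IsIIDGaussianProjection Θ P) (i : Fin k) (j : Fin n) :
    ∫ ω, Θ ω i j ∂P = 0 := by
  rw [← integral_map (f := fun x => x) (hΘ.measurable_entry i j).aemeasurable (by fun_prop),
    hΘ.map_entry, integral_id_gaussianReal]

lemma covariance_entry (hΘ : IsIIDGaussianProjection Θ P) (i i' : Fin k) (j j' : Fin n) :
    cov[fun ω => Θ ω i j, fun ω => Θ ω i' j'; P] = if i = i' ∧ j = j' then 1 / (n : ℝ) else 0 := by
  split_ifs with h
  · obtain ⟨rfl, rfl⟩ := h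
    rw [covariance_self (hΘ.measurable_entry i j).aemeasurable]
    have := variance_map (X := fun x : ℝ => x) (μ := P) (Y := fun ω => Θ ω i j) (by fun_prop)
      (hΘ.measurable_entry i j).aemeasurable
    rw [hΘ.map_entry, variance_fun_id_gaussianReal] at this
    simpa [Function.comp_def] using this.symm
  · refine IndepFun.covariance_eq_zero ?_ (hΘ.hasGaussianLaw_entry i j).memLp_two
      (hΘ.hasGaussianLaw_entry i' j').memLp_two
    exact hΘ.iIndepFun_entries.indepFun (i := (i, j)) (j := (i', j')) (by simpa using h)

lemma covariance_sum_entries [IsProbabilityMeasure P] (hΘ : IsIIDGaussianProjection Θ P)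
    (i i' : Fin k) (u v : Fin n → ℝ) :
    cov[fun ω => ∑ j, u j * Θ ω i j, fun ω => ∑ j, v j * Θ ω i' j; P] =
      if i = i' then (∑ j, u j * v j) / n else 0 := by
  rw [covariance_fun_sum_fun_sum
    (fun j => (hΘ.hasGaussianLaw_entry i j).memLp_two.const_mul _)
    (fun j => (hΘ.hasGaussianLaw_entry i' j).memLp_two.const_mul _)]
  simp_rw [covariance_const_mul_left, covariance_const_mul_right, hΘ.covariance_entry]
  split_ifs with h
  · simp [h, Finset.sum_mul, mul_assoc, div_eq_mul_inv]
  · simp [h]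

lemma hasGaussianLaw_sum_entries (hΘ : IsIIDGaussianProjection Θ P) {ι : Type*} [Finite ι]
    (r : ι → Fin k) (w : ι → Fin n → ℝ) :
    HasGaussianLaw (fun ω (l : ι) => ∑ j, w l j * Θ ω (r l) j) P := by
  have := Fintype.ofFinite ι
  have h := hΘ.hasGaussianLaw_entries.map_fun (ContinuousLinearMap.pi fun l : ι =>
    ∑ j, w l j • ContinuousLinearMap.proj (R := ℝ) (φ := fun _ : Fin k × Fin n => ℝ) (r l, j))
  refine h.congr (.of_forall fun ω => ?_)
  ext l
  simp

variable [IsProbabilityMeasure P]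

lemma map_sum_entries (hΘ : IsIIDGaussianProjection Θ P) (i : Fin k) (w : Fin n → ℝ) :
    P.map (fun ω => ∑ j, w j * Θ ω i j) = gaussianReal 0 ((∑ j, w j ^ 2) / n).toNNReal := by
  have h := (hΘ.hasGaussianLaw_sum_entries (ι := Unit) (fun _ => i) (fun _ => w)).eval ()
  have hm : Measurable fun ω => ∑ j, w j * Θ ω i j :=
    Finset.measurable_sum _ fun j _ => (hΘ.measurable_entry i j).const_mul _
  rw [h.map_eq_gaussianReal]
  congr 1
  · rw [integral_finsetSum _ fun j _ => (hΘ.hasGaussianLaw_entry i j).integrable.const_mul _]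
    simp [integral_const_mul, hΘ.integral_entry]
  · rw [← covariance_self hm.aemeasurable, hΘ.covariance_sum_entries]
    simp [sq]

/-- The images of two orthogonal vectors under `Θ` have independent Gaussian coordinates. -/
lemma lintegral_prod_sum_entries (hΘ : IsIIDGaussianProjection Θ P) (u v : Fin n → ℝ)
    (huv : ∑ j, u j * v j = 0) {f g : Fin k → ℝ → ℝ≥0∞} (hf : ∀ i, Measurable (f i))
    (hg : ∀ i, Measurable (g i)) :
    ∫⁻ ω, ∏ i, (f i (∑ j, u j * Θ ω i j) * g i (∑ j, v j * Θ ω i j)) ∂P =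
      ∏ i, ((∫⁻ x, f i x ∂(gaussianReal 0 ((∑ j, u j ^ 2) / n).toNNReal)) *
        ∫⁻ x, g i x ∂(gaussianReal 0 ((∑ j, v j ^ 2) / n).toNNReal)) := by
  set w : Bool → Fin n → ℝ := fun b => if b then u else v
  set V : Fin k × Bool → Ω → ℝ := fun l ω => ∑ j, w l.2 j * Θ ω l.1 j with hV
  have hVm : ∀ l, Measurable (V l) := fun l =>
    Finset.measurable_sum _ fun j _ => (hΘ.measurable_entry l.1 j).const_mul _
  have hind : iIndepFun V P := by
    -- The family is jointly Gaussian, so vanishing covariances suffice: different rows are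
    -- uncorrelated, and within a row the covariance is ⟨u, v⟩/n = 0.
    refine HasGaussianLaw.iIndepFun_of_covariance_eq_zero
      (hΘ.hasGaussianLaw_sum_entries (fun l : Fin k × Bool => l.1) fun l => w l.2) ?_
    rintro ⟨i, b⟩ ⟨i', b'⟩ hne
    simp only [hV]
    rw [hΘ.covariance_sum_entries]
    split_ifs with hi
    · subst hi
      have huv' : ∑ j, v j * u j = 0 := by simpa [mul_comm] using huv
      cases b <;> cases b' <;> simp_all [w]
    · rfl
  set F : Fin k × Bool → ℝ → ℝ≥0∞ := fun l => if l.2 then f l.1 else g l.1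
  have hF : ∀ l, Measurable (F l) := by
    rintro ⟨i, b⟩
    cases b
    · exact hg i
    · exact hf i
  have key := lintegral_prod_eq_prod_lintegral_of_indepFun Finset.univ (fun l ω => F l (V l ω))
    (hind.comp F hF) (fun l => (hF l).comp (hVm l))
  have hl : ∀ l, ∫⁻ ω, F l (V l ω) ∂P
      = ∫⁻ x, F l x ∂(gaussianReal 0 ((∑ j, w l.2 j ^ 2) / n).toNNReal) := fun l => by
    rw [← hΘ.map_sum_entries l.1, lintegral_map (hF l) (hVm l)]
  simp_rw [hl, Fintype.prod_prod_type, Fintype.prod_bool] at key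
  simpa [F, V, w] using key

end IsIIDGaussianProjection

/-! ### Averaging likelihood ratios over Θ -/

/-- Mixing N(x, t) over x ~ N(0, γ) gives N(0, γ + t), the reference measure itself. -/
lemma lintegral_gaussianRatio_gaussianReal {γ t : ℝ} (hγ : 0 < γ) (ht : 0 < t) (y : ℝ) :
    ∫⁻ x, gaussianRatio t (γ + t) x y ∂(gaussianReal 0 γ.toNNReal) = 1 := by
  have hg : (γ.toNNReal : ℝ) = γ := Real.coe_toNNReal _ hγ.le
  have h := lintegral_exp_quadratic_gaussianReal γ.toNNReal (-(1 / (2 * t))) (y / t) (by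
    rw [hg]
    have : 0 < 2 * (1 / (2 * t)) * γ := by positivity
    linarith)
  have e : ∀ x, gaussianRatio t (γ + t) x y =
      ENNReal.ofReal (√((γ + t) / t) * Real.exp (-y ^ 2 / (2 * t) + y ^ 2 / (2 * (γ + t)))) *
      ENNReal.ofReal (Real.exp (-(1 / (2 * t)) * x ^ 2 + y / t * x)) := fun x => by
    rw [gaussianRatio, ← ENNReal.ofReal_mul (by positivity), mul_assoc, ← Real.exp_add]
    congr 3
    field_simp
    ring
  simp_rw [e]
  rw [lintegral_const_mul _ (by fun_prop), h, hg, ← ENNReal.ofReal_mul (by positivity),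
    show 1 - 2 * -(1 / (2 * t)) * γ = (γ + t) / t by field_simp; ring]
  rw [← ENNReal.ofReal_one]
  congr 1
  have : √((γ + t) / t) ≠ 0 := by positivity
  rw [mul_mul_mul_comm, mul_inv_cancel₀ this, one_mul, ← Real.exp_add, Real.exp_eq_one_iff]
  field_simp
  ring

/-- The likelihood ratio at means `(p + q) / 2` and `(p - q) / 2` factorizes in `p` and `q`. -/
lemma gaussianRatio_mul_gaussianRatio {t s : ℝ} (ht : 0 < t) (hs : 0 < s) (p q y : ℝ) :
    gaussianRatio t s ((p + q) / 2) y * gaussianRatio t s ((p - q) / 2) y =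
      ENNReal.ofReal (s / t * Real.exp (-y ^ 2 / t + y ^ 2 / s)) *
        ENNReal.ofReal (Real.exp (-(1 / (4 * t)) * p ^ 2 + y / t * p)) *
        ENNReal.ofReal (Real.exp (-(1 / (4 * t)) * q ^ 2 + 0 * q)) := by
  rw [gaussianRatio, gaussianRatio, ← ENNReal.ofReal_mul (by positivity),
    ← ENNReal.ofReal_mul (by positivity), ← ENNReal.ofReal_mul (by positivity)]
  congr 1
  rw [mul_mul_mul_comm, Real.mul_self_sqrt (by positivity), mul_assoc, mul_assoc,
    ← Real.exp_add, ← Real.exp_add, ← Real.exp_add]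
  congr 2
  field_simp
  ring

/-- Here `p` and `q` stand for the sum and difference of two Gaussians of variance γ and covariance
ρ, hence the variances 2(γ ± ρ), nonnegative by `hρ`. The result is Mehler's kernel with correlation
ρ/(γ + t) and both arguments y/√(γ + t). -/
lemma lintegral_gaussianRatio_mul {γ t ρ : ℝ} (ht : 0 < t) (hρ : |ρ| ≤ γ) (hγ : 0 < γ) (y : ℝ) :
    (∫⁻ p, (ENNReal.ofReal (((γ + t)) / t * Real.exp (-y ^ 2 / t + y ^ 2 / (γ + t))) *
        ENNReal.ofReal (Real.exp (-(1 / (4 * t)) * p ^ 2 + y / t * p)))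
        ∂(gaussianReal 0 (2 * (γ + ρ)).toNNReal)) *
      (∫⁻ q, ENNReal.ofReal (Real.exp (-(1 / (4 * t)) * q ^ 2 + 0 * q))
        ∂(gaussianReal 0 (2 * (γ - ρ)).toNNReal)) =
      ENNReal.ofReal (mehlerDiag (y ^ 2 / (γ + t)) (ρ / (γ + t))) := by
  obtain ⟨h1, h2⟩ := abs_le.1 hρ
  have hp : 0 ≤ 2 * (γ + ρ) := by linarith
  have hq : 0 ≤ 2 * (γ - ρ) := by linarith
  have hsp : 0 < γ + t + ρ := by linarith
  have hsq : 0 < γ + t - ρ := by linarith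
  have hs : 0 < γ + t := by linarith
  have e1 : 1 - 2 * -(1 / (4 * t)) * (2 * (γ + ρ)) = (γ + t + ρ) / t := by field_simp; ring
  have e2 : 1 - 2 * -(1 / (4 * t)) * (2 * (γ - ρ)) = (γ + t - ρ) / t := by field_simp; ring
  rw [lintegral_const_mul _ (by fun_prop), lintegral_exp_quadratic_gaussianReal _ _ _ ?_,
    lintegral_exp_quadratic_gaussianReal _ _ _ ?_, Real.coe_toNNReal _ hp, Real.coe_toNNReal _ hq,
    e1, e2, ← ENNReal.ofReal_mul (by positivity), ← ENNReal.ofReal_mul (by positivity)]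
  · congr 1
    rw [mehlerDiag]
    have hr : √(1 - (ρ / (γ + t)) ^ 2) = √((γ + t + ρ) / t) * √((γ + t - ρ) / t) * (t / (γ + t)) := by
      rw [← Real.sqrt_mul (by positivity), Real.sqrt_eq_iff_mul_self_eq_of_pos]
      · have := Real.mul_self_sqrt (show 0 ≤ (γ + t + ρ) / t * ((γ + t - ρ) / t) by positivity)
        rw [mul_mul_mul_comm, this]
        field_simp
        ring
      · positivity
    rw [hr]
    have n1 : √((γ + t + ρ) / t) ≠ 0 := by positivity
    have n2 : √((γ + t - ρ) / t) ≠ 0 := by positivity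
    have : y ^ 2 / (γ + t) * (ρ / (γ + t) / (1 + ρ / (γ + t)))
        = (-y ^ 2 / t + y ^ 2 / (γ + t)) + (y / t) ^ 2 * (2 * (γ + ρ)) / (2 * ((γ + t + ρ) / t)) := by
      have : 1 + ρ / (γ + t) = (γ + t + ρ) / (γ + t) := by field_simp
      rw [this]
      field_simp
      ring
    rw [this, Real.exp_add (-y ^ 2 / t + y ^ 2 / (γ + t))]
    simp only [ne_eq, OfNat.ofNat_ne_zero, not_false_eq_true, zero_pow, zero_mul, zero_div,
      Real.exp_zero, mul_one]
    field_simp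
  · rw [Real.coe_toNNReal _ hq]
    have : 0 < (γ + t - ρ) / t := by positivity
    linarith
  · rw [Real.coe_toNNReal _ hp]
    have : 0 < (γ + t + ρ) / t := by positivity
    linarith

namespace IsIIDGaussianProjection

variable {Ω : Type*} [MeasurableSpace Ω] {P : Measure Ω} {k n : ℕ}
  {Θ : Ω → Matrix (Fin k) (Fin n) ℝ} [IsProbabilityMeasure P]

lemma lintegral_prod_gaussianRatio (hΘ : IsIIDGaussianProjection Θ P) {γ t : ℝ} (hγ : 0 < γ)
    (ht : 0 < t) {x : Fin n → ℝ} (hx : (∑ j, x j ^ 2) / n = γ) (y : Fin k → ℝ) :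
    ∫⁻ ω, ∏ i, gaussianRatio t (γ + t) ((Θ ω *ᵥ x) i) (y i) ∂P = 1 := by
  -- The zero vector is orthogonal to everything, so the two-vector lemma also covers a single
  -- vector.
  have h := hΘ.lintegral_prod_sum_entries x 0 (by simp)
    (f := fun i p => gaussianRatio t (γ + t) p (y i)) (g := fun _ _ => 1)
    (fun i => by fun_prop) (fun i => by fun_prop)
  simp only [mul_one, hx, lintegral_gaussianRatio_gaussianReal hγ ht, lintegral_const,
    measure_univ, Finset.prod_const_one] at h
  rw [← h]
  simp_rw [Matrix.mulVec, dotProduct, mul_comm]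

lemma lintegral_prod_gaussianRatio_mul (hΘ : IsIIDGaussianProjection Θ P) {γ t : ℝ} (hγ : 0 < γ)
    (ht : 0 < t) {x x' : Fin n → ℝ} (hx : (∑ j, x j ^ 2) / n = γ) (hx' : (∑ j, x' j ^ 2) / n = γ)
    {ρ : ℝ} (hρ : (∑ j, x j * x' j) / n = ρ) (hργ : |ρ| ≤ γ) (hn : n ≠ 0) (y : Fin k → ℝ) :
    ∫⁻ ω, (∏ i, gaussianRatio t (γ + t) ((Θ ω *ᵥ x) i) (y i)) *
        ∏ i, gaussianRatio t (γ + t) ((Θ ω *ᵥ x') i) (y i) ∂P =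
      ENNReal.ofReal (∏ i, mehlerDiag (y i ^ 2 / (γ + t)) (ρ / (γ + t))) := by
  have hn' : (n : ℝ) ≠ 0 := by exact_mod_cast hn
  -- Orthogonality of sum and difference is exactly equality of the two norms.
  have huv : ∑ j, (x + x') j * (x - x') j = 0 := by
    have : ∑ j, (x + x') j * (x - x') j = ∑ j, x j ^ 2 - ∑ j, x' j ^ 2 := by
      rw [← Finset.sum_sub_distrib]
      exact Finset.sum_congr rfl fun j _ => by simp only [Pi.add_apply, Pi.sub_apply]; ring
    rw [this]
    field_simp at hx hx'
    linarith
  have hu : (∑ j, (x + x') j ^ 2) / n = 2 * (γ + ρ) := by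
    have : ∑ j, (x + x') j ^ 2 = ∑ j, x j ^ 2 + ∑ j, x' j ^ 2 + 2 * ∑ j, x j * x' j := by
      rw [← Finset.sum_add_distrib, Finset.mul_sum, ← Finset.sum_add_distrib]
      exact Finset.sum_congr rfl fun j _ => by simp only [Pi.add_apply]; ring
    rw [this, add_div, add_div, hx, hx', mul_div_assoc, hρ]; ring
  have hv : (∑ j, (x - x') j ^ 2) / n = 2 * (γ - ρ) := by
    have : ∑ j, (x - x') j ^ 2 = ∑ j, x j ^ 2 + ∑ j, x' j ^ 2 - 2 * ∑ j, x j * x' j := by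
      rw [← Finset.sum_add_distrib, Finset.mul_sum, ← Finset.sum_sub_distrib]
      exact Finset.sum_congr rfl fun j _ => by simp only [Pi.sub_apply]; ring
    rw [this, sub_div, add_div, hx, hx', mul_div_assoc, hρ]; ring
  have h := hΘ.lintegral_prod_sum_entries (x + x') (x - x') huv
    (f := fun i p => ENNReal.ofReal ((γ + t) / t *
        Real.exp (-(y i) ^ 2 / t + (y i) ^ 2 / (γ + t))) *
      ENNReal.ofReal (Real.exp (-(1 / (4 * t)) * p ^ 2 + y i / t * p)))
    (g := fun _ q => ENNReal.ofReal (Real.exp (-(1 / (4 * t)) * q ^ 2 + 0 * q)))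
    (fun i => by fun_prop) (fun i => by fun_prop)
  rw [hu, hv] at h
  simp_rw [lintegral_gaussianRatio_mul ht hργ hγ] at h
  rw [ENNReal.ofReal_prod_of_nonneg fun i _ => by unfold mehlerDiag; positivity, ← h]
  refine lintegral_congr fun ω => ?_
  rw [← Finset.prod_mul_distrib]
  refine Finset.prod_congr rfl fun i _ => ?_
  rw [← gaussianRatio_mul_gaussianRatio ht (by linarith : 0 < γ + t)]
  have e1 : (Θ ω *ᵥ x) i = (∑ j, (x + x') j * Θ ω i j + ∑ j, (x - x') j * Θ ω i j) / 2 := by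
    rw [← Finset.sum_add_distrib, Finset.sum_div, Matrix.mulVec, dotProduct]
    exact Finset.sum_congr rfl fun j _ => by simp only [Pi.add_apply, Pi.sub_apply]; ring
  have e2 : (Θ ω *ᵥ x') i = (∑ j, (x + x') j * Θ ω i j - ∑ j, (x - x') j * Θ ω i j) / 2 := by
    rw [← Finset.sum_sub_distrib, Finset.sum_div, Matrix.mulVec, dotProduct]
    exact Finset.sum_congr rfl fun j _ => by simp only [Pi.add_apply, Pi.sub_apply]; ring
  rw [e1, e2]

end IsIIDGaussianProjection

/-! ### The conditional law of Y given Θ and the law of Y -/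

lemma measurable_mulVec_apply {k n : ℕ} (i : Fin k) :
    Measurable fun p : Matrix (Fin k) (Fin n) ℝ × EuclideanSpace ℝ (Fin n) =>
      (p.1 *ᵥ p.2.ofLp) i := by
  have h : ∀ j, Measurable fun θ : Matrix (Fin k) (Fin n) ℝ => θ i j := fun j =>
    (measurable_pi_apply j).comp (measurable_pi_apply (X := fun _ : Fin k => Fin n → ℝ) i)
  simp_rw [Matrix.mulVec, dotProduct]
  exact Finset.measurable_sum _ fun j _ => ((h j).comp measurable_fst).mul (by fun_prop)

/-- The density of `P_{Y|Θ=θ}` with respect to the centred Gaussian with covariance `s • 1`, where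
`Y = Θ X + √t N` and `X` has law `μ`. -/
def condDensity {k n : ℕ} (t s : ℝ) (μ : Measure (EuclideanSpace ℝ (Fin n)))
    (θ : Matrix (Fin k) (Fin n) ℝ) (y : EuclideanSpace ℝ (Fin k)) : ℝ≥0∞ :=
  ∫⁻ x, ∏ i, gaussianRatio t s ((θ *ᵥ x.ofLp) i) (y i) ∂μ

lemma measurable_prod_gaussianRatio {k n : ℕ} (t s : ℝ) :
    Measurable fun p : (Matrix (Fin k) (Fin n) ℝ × EuclideanSpace ℝ (Fin k)) ×
      EuclideanSpace ℝ (Fin n) => ∏ i, gaussianRatio t s ((p.1.1 *ᵥ p.2.ofLp) i) (p.1.2 i) := by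
  refine Finset.measurable_prod _ fun i _ => measurable_gaussianRatio _ _ ?_ (by fun_prop)
  exact (measurable_mulVec_apply i).comp
    ((measurable_fst.comp measurable_fst).prodMk measurable_snd)

section

variable {k n : ℕ} (μ : Measure (EuclideanSpace ℝ (Fin n))) [IsProbabilityMeasure μ]

lemma measurable_condDensity (t s : ℝ) :
    Measurable fun p : Matrix (Fin k) (Fin n) ℝ × EuclideanSpace ℝ (Fin k) =>
      condDensity t s μ p.1 p.2 :=
  (measurable_prod_gaussianRatio t s).lintegral_prod_right'

lemma measurable_condDensity_comp {α : Type*} [MeasurableSpace α] (t s : ℝ)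
    {f : α → Matrix (Fin k) (Fin n) ℝ} {g : α → EuclideanSpace ℝ (Fin k)} (hf : Measurable f)
    (hg : Measurable g) : Measurable fun a => condDensity t s μ (f a) (g a) := by
  have h := (measurable_condDensity (k := k) μ t s).comp (hf.prodMk hg)
  simpa only [Function.comp_def] using h

lemma lintegral_condDensity {t s : ℝ≥0} (ht : t ≠ 0) (hs : s ≠ 0)
    (θ : Matrix (Fin k) (Fin n) ℝ) : ∫⁻ y, condDensity t s μ θ y ∂(isoGaussian k s) = 1 := by
  unfold condDensity
  rw [lintegral_lintegral_swap]
  · have h := fun x : EuclideanSpace ℝ (Fin n) => lintegral_stdGaussian_add ht hs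
      (WithLp.toLp 2 (θ *ᵥ x.ofLp)) (f := fun _ => 1) (by fun_prop)
    simp only [mul_one, lintegral_const, measure_univ] at h
    simp_rw [← h]
    simp
  · exact ((measurable_prod_gaussianRatio (t : ℝ) (s : ℝ)).comp
      ((measurable_const.prodMk measurable_fst).prodMk measurable_snd)).aemeasurable

/-- The conditional law of `Θ X + √t N` given `Θ`, where `X` has law `μ`. -/
def condKernelY (t s : ℝ≥0) : Kernel (Matrix (Fin k) (Fin n) ℝ) (EuclideanSpace ℝ (Fin k)) :=
  Kernel.withDensity (Kernel.const _ (isoGaussian k s)) (condDensity t s μ)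

lemma condKernelY_apply (t s : ℝ≥0) (θ : Matrix (Fin k) (Fin n) ℝ) :
    condKernelY μ t s θ = (isoGaussian k s).withDensity (condDensity t s μ θ) := by
  rw [condKernelY, Kernel.withDensity_apply _ (measurable_condDensity μ t s), Kernel.const_apply]

lemma isMarkovKernel_condKernelY {t s : ℝ≥0} (ht : t ≠ 0) (hs : s ≠ 0) :
    IsMarkovKernel (condKernelY (k := k) μ t s) := by
  refine ⟨fun θ => ⟨?_⟩⟩
  rw [condKernelY_apply, withDensity_apply _ MeasurableSet.univ, Measure.restrict_univ,
    lintegral_condDensity μ ht hs]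

end

section

variable {Ω : Type*} [MeasurableSpace Ω] {P : Measure Ω} [IsProbabilityMeasure P] {k n : ℕ}
  {X : Ω → EuclideanSpace ℝ (Fin n)} {Θ : Ω → Matrix (Fin k) (Fin n) ℝ}
  {N : Ω → EuclideanSpace ℝ (Fin k)}

lemma measurable_toLp_mulVec : Measurable
    fun p : Matrix (Fin k) (Fin n) ℝ × EuclideanSpace ℝ (Fin n) =>
      (WithLp.toLp 2 (p.1 *ᵥ p.2.ofLp) : EuclideanSpace ℝ (Fin k)) :=
  (WithLp.measurable_toLp 2 _).comp (measurable_pi_lambda _ measurable_mulVec_apply)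

lemma measurable_projY (hX : Measurable X) (hΘ : Measurable Θ) (hN : Measurable N) (t : ℝ) :
    Measurable (projY Θ X N t) :=
  (measurable_toLp_mulVec.comp (hΘ.prodMk hX)).add (hN.const_smul √t)

lemma lintegral_projY (hX : Measurable X) (hΘ : Measurable Θ) (hN : Measurable N)
    (hN_law : P.map N = stdGaussian (EuclideanSpace ℝ (Fin k)))
    (h_indep : IndepFun Θ X P) (h_indep_noise : IndepFun (fun ω => (Θ ω, X ω)) N P)
    {t s : ℝ≥0} (ht : t ≠ 0) (hs : s ≠ 0)
    {f : Matrix (Fin k) (Fin n) ℝ × EuclideanSpace ℝ (Fin k) → ℝ≥0∞} (hf : Measurable f) :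
    ∫⁻ ω, f (Θ ω, projY Θ X N t ω) ∂P =
      ∫⁻ ω, ∫⁻ y, condDensity t s (P.map X) (Θ ω) y * f (Θ ω, y) ∂(isoGaussian k s) ∂P := by
  have := Measure.isProbabilityMeasure_map (μ := P) hX.aemeasurable
  have := Measure.isProbabilityMeasure_map (μ := P) hΘ.aemeasurable
  have h1 := (indepFun_iff_map_prod_eq_prod_map_map hΘ.aemeasurable hX.aemeasurable).1 h_indep
  have h2 := (indepFun_iff_map_prod_eq_prod_map_map (hΘ.prodMk hX).aemeasurable
    hN.aemeasurable).1 h_indep_noise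
  rw [h1, hN_law] at h2
  have hg : Measurable fun p : (Matrix (Fin k) (Fin n) ℝ × EuclideanSpace ℝ (Fin n)) ×
      EuclideanSpace ℝ (Fin k) =>
      f (p.1.1, WithLp.toLp 2 (p.1.1 *ᵥ p.1.2.ofLp) + √(t : ℝ) • p.2) :=
    hf.comp ((measurable_fst.comp measurable_fst).prodMk
      ((measurable_toLp_mulVec.comp measurable_fst).add (measurable_snd.const_smul √(t : ℝ))))
  have hfm : ∀ θ, Measurable fun y => f (θ, y) := fun θ => hf.comp (by fun_prop)
  have hr : Measurable fun p : (Matrix (Fin k) (Fin n) ℝ × EuclideanSpace ℝ (Fin n)) ×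
      EuclideanSpace ℝ (Fin k) =>
      (∏ i, gaussianRatio t s ((p.1.1 *ᵥ p.1.2.ofLp) i) (p.2 i)) * f (p.1.1, p.2) :=
    ((measurable_prod_gaussianRatio (t : ℝ) (s : ℝ)).comp
      (((measurable_fst.comp measurable_fst).prodMk measurable_snd).prodMk
        (measurable_snd.comp measurable_fst))).mul
      (hf.comp ((measurable_fst.comp measurable_fst).prodMk measurable_snd))
  calc ∫⁻ ω, f (Θ ω, projY Θ X N t ω) ∂P
      = ∫⁻ p, f (p.1.1, WithLp.toLp 2 (p.1.1 *ᵥ p.1.2.ofLp) + √(t : ℝ) • p.2)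
          ∂(((P.map Θ).prod (P.map X)).prod (stdGaussian (EuclideanSpace ℝ (Fin k)))) := by
        rw [← h2, lintegral_map hg ((hΘ.prodMk hX).prodMk hN)]
        rfl
    _ = ∫⁻ q, ∫⁻ y, (∏ i, gaussianRatio t s ((q.1 *ᵥ q.2.ofLp) i) (y i)) * f (q.1, y)
          ∂(isoGaussian k s) ∂((P.map Θ).prod (P.map X)) := by
        rw [lintegral_prod _ hg.aemeasurable]
        refine lintegral_congr fun q => ?_
        exact lintegral_stdGaussian_add ht hs (WithLp.toLp 2 (q.1 *ᵥ q.2.ofLp)) (hfm q.1)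
    _ = ∫⁻ θ, ∫⁻ y, condDensity t s (P.map X) θ y * f (θ, y) ∂(isoGaussian k s) ∂(P.map Θ) := by
        rw [lintegral_prod _ hr.lintegral_prod_right'.aemeasurable]
        refine lintegral_congr fun θ => ?_
        rw [lintegral_lintegral_swap]
        · refine lintegral_congr fun y => ?_
          dsimp only
          rw [condDensity, lintegral_mul_const]
          have h := (measurable_prod_gaussianRatio (k := k) (n := n) (t : ℝ) (s : ℝ)).comp
            ((measurable_const (a := (θ, y))).prodMk measurable_id)
          simpa only [Function.comp_def, id_eq] using h
        · exact (hr.comp ((measurable_const.prodMk measurable_fst).prodMk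
            measurable_snd)).aemeasurable
    _ = _ := by
        have hm : Measurable fun p : Matrix (Fin k) (Fin n) ℝ × EuclideanSpace ℝ (Fin k) =>
            condDensity t s (P.map X) p.1 p.2 * f p :=
          (measurable_condDensity_comp _ _ _ measurable_fst measurable_snd).mul hf
        rw [lintegral_map hm.lintegral_prod_right' hΘ]

/-- A conditional distribution is determined almost everywhere by the joint law of (Θ, Y), which
`lintegral_projY` computes by disintegrating over independent Θ, X and N. -/
lemma condDistrib_projY (hX : Measurable X) (hΘ : Measurable Θ) (hN : Measurable N)
    (hN_law : P.map N = stdGaussian (EuclideanSpace ℝ (Fin k)))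
    (h_indep : IndepFun Θ X P) (h_indep_noise : IndepFun (fun ω => (Θ ω, X ω)) N P)
    {t s : ℝ≥0} (ht : t ≠ 0) (hs : s ≠ 0) :
    condDistrib (projY Θ X N t) Θ P =ᵐ[P.map Θ] condKernelY (P.map X) t s := by
  have := Measure.isProbabilityMeasure_map (μ := P) hX.aemeasurable
  have := Measure.isProbabilityMeasure_map (μ := P) hΘ.aemeasurable
  have := isMarkovKernel_condKernelY (k := k) (P.map X) ht hs
  have hY := measurable_projY hX hΘ hN t
  refine condDistrib_ae_eq_of_measure_eq_compProd_of_measurable hΘ hY ?_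
  refine Measure.ext_of_lintegral _ fun f hf => ?_
  rw [lintegral_map hf (hΘ.prodMk hY), Measure.lintegral_compProd hf,
    lintegral_projY hX hΘ hN hN_law h_indep h_indep_noise ht hs hf,
    lintegral_map hf.lintegral_kernel_prod_right' hΘ]
  refine lintegral_congr fun ω => ?_
  have hr : Measurable (condDensity t s (P.map X) (Θ ω)) :=
    measurable_condDensity_comp _ _ _ measurable_const measurable_id
  have hf' : Measurable fun y => f (Θ ω, y) := hf.comp (measurable_const.prodMk measurable_id)
  rw [condKernelY_apply, lintegral_withDensity_eq_lintegral_mul _ hr hf']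
  rfl

/-- Used twice: it identifies the law of Y, and it makes Θ ↦ r_Θ(y) a probability density for each
single y, as the entropy bound requires. -/
lemma lintegral_condDensity_comp (hΘ : IsIIDGaussianProjection Θ P)
    (μ : Measure (EuclideanSpace ℝ (Fin n))) [IsProbabilityMeasure μ] {γ t : ℝ} (hγ : 0 < γ)
    (ht : 0 < t) (hμ : ∀ᵐ x ∂μ, (∑ j, x.ofLp j ^ 2) / n = γ) (y : EuclideanSpace ℝ (Fin k)) :
    ∫⁻ ω, condDensity t (γ + t) μ (Θ ω) y ∂P = 1 := by
  unfold condDensity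
  rw [lintegral_lintegral_swap]
  · rw [lintegral_congr_ae (g := fun _ => 1)]
    · simp
    · filter_upwards [hμ] with x hx
      exact hΘ.lintegral_prod_gaussianRatio hγ ht hx y
  · exact ((measurable_prod_gaussianRatio t (γ + t)).comp
      (((hΘ.measurable.comp measurable_fst).prodMk measurable_const).prodMk
        measurable_snd)).aemeasurable

lemma map_projY (hX : Measurable X) (hΘ : IsIIDGaussianProjection Θ P) (hN : Measurable N)
    (hN_law : P.map N = stdGaussian (EuclideanSpace ℝ (Fin k)))
    (h_indep : IndepFun Θ X P) (h_indep_noise : IndepFun (fun ω => (Θ ω, X ω)) N P)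
    {γ t : ℝ≥0} (hγ : γ ≠ 0) (ht : t ≠ 0)
    (hsphere : ∀ᵐ x ∂(P.map X), (∑ j, x.ofLp j ^ 2) / n = (γ : ℝ)) :
    P.map (projY Θ X N t) = isoGaussian k (γ + t) := by
  have := Measure.isProbabilityMeasure_map (μ := P) hX.aemeasurable
  refine Measure.ext_of_lintegral _ fun f hf => ?_
  have h := lintegral_projY hX hΘ.measurable hN hN_law h_indep h_indep_noise ht
    (s := γ + t) (by simp [hγ]) (f := fun p => f p.2) (hf.comp measurable_snd)
  rw [lintegral_map hf (measurable_projY hX hΘ.measurable hN t), h, lintegral_lintegral_swap]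
  · refine lintegral_congr fun y => ?_
    dsimp only
    rw [lintegral_mul_const, NNReal.coe_add,
      lintegral_condDensity_comp hΘ _ (by positivity) (by positivity) hsphere, one_mul]
    exact measurable_condDensity_comp _ _ _ hΘ.measurable measurable_const
  · exact ((measurable_condDensity_comp _ _ _ (hΘ.measurable.comp measurable_fst)
      measurable_snd).mul (hf.comp measurable_snd)).aemeasurable

end

/-! ### The Gaussian approximation and elementary inequalities -/

lemma gaussianApprox_of_map_eq {Ω : Type*} [MeasurableSpace Ω] {P : Measure Ω} {k : ℕ}
    {Y : Ω → EuclideanSpace ℝ (Fin k)} (hY : Measurable Y) {s : ℝ≥0}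
    (h : P.map Y = isoGaussian k s) : gaussianApprox Y P = isoGaussian k s := by
  rw [← multivariateGaussian_smul_one] at h ⊢
  rw [gaussianApprox]
  congr 1
  · rw [← integral_map (f := fun y => y) hY.aemeasurable (by fun_prop), h,
      integral_id_multivariateGaussian]
  · ext i j
    have := covariance_map_fun (μ := P) (Z := Y) (X := fun y => y i) (Y := fun y => y j)
      (by fun_prop) (by fun_prop) hY.aemeasurable
    rw [Matrix.of_apply, ← this, h,
      covariance_eval_multivariateGaussian (posSemidef_smul_one k s)]

/-- Jensen's inequality for the logarithm under the measure r dμ, in tangent-line form: log(r/c) ≤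
r/c - 1, multiplied by r, integrates to log c + E[r²]/c - 1 ≤ log c. -/
lemma lintegral_klFun_le_log {α : Type*} [MeasurableSpace α] (μ : Measure α)
    [IsProbabilityMeasure μ] {r : α → ℝ≥0∞} (hr : Measurable r) (h1 : ∫⁻ x, r x ∂μ = 1) {c : ℝ}
    (hc : 0 < c) (h2 : ∫⁻ x, r x ^ 2 ∂μ ≤ ENNReal.ofReal c) :
    ∫⁻ x, ENNReal.ofReal (klFun (r x).toReal) ∂μ ≤ ENNReal.ofReal (Real.log c) := by
  have h1' : ∫⁻ x, r x ∂μ ≠ ∞ := by simp [h1]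
  have h2' : ∫⁻ x, r x ^ 2 ∂μ ≠ ∞ := (h2.trans_lt ENNReal.ofReal_lt_top).ne
  have i1 : Integrable (fun x => (r x).toReal) μ :=
    integrable_toReal_of_lintegral_ne_top hr.aemeasurable h1'
  have i2 : Integrable (fun x => (r x).toReal ^ 2) μ := by
    simpa using integrable_toReal_of_lintegral_ne_top (hr.pow_const 2).aemeasurable h2'
  have e1 : ∫ x, (r x).toReal ∂μ = 1 := by
    rw [integral_toReal hr.aemeasurable (ae_lt_top hr h1'), h1, ENNReal.toReal_one]
  have e2 : ∫ x, (r x).toReal ^ 2 ∂μ ≤ c := by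
    have := integral_toReal (hr.pow_const 2).aemeasurable (ae_lt_top (hr.pow_const 2) h2')
    simp only [ENNReal.toReal_pow] at this
    rw [this]
    exact ENNReal.toReal_le_of_le_ofReal hc.le h2
  have hle : ∀ x : ℝ, 0 ≤ x → klFun x ≤ x * Real.log c + x ^ 2 / c - 2 * x + 1 := fun x hx => by
    rcases hx.eq_or_lt with rfl | hx
    · simp [klFun]
    · have := Real.log_le_sub_one_of_pos (div_pos hx hc)
      rw [Real.log_div hx.ne' hc.ne'] at this
      have := mul_le_mul_of_nonneg_left this hx.le
      rw [klFun]
      have e : x * (x / c - 1) = x ^ 2 / c - x := by ring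
      linarith
  have ig : Integrable (fun x => (r x).toReal * Real.log c + (r x).toReal ^ 2 / c
      - 2 * (r x).toReal + 1) μ :=
    (((i1.mul_const _).add (i2.div_const _)).sub (i1.const_mul 2)).add (integrable_const 1)
  calc ∫⁻ x, ENNReal.ofReal (klFun (r x).toReal) ∂μ
      ≤ ∫⁻ x, ENNReal.ofReal ((r x).toReal * Real.log c + (r x).toReal ^ 2 / c
          - 2 * (r x).toReal + 1) ∂μ :=
        lintegral_mono fun x => ENNReal.ofReal_le_ofReal (hle _ ENNReal.toReal_nonneg)
    _ = ENNReal.ofReal (∫ x, (r x).toReal * Real.log c + (r x).toReal ^ 2 / c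
          - 2 * (r x).toReal + 1 ∂μ) :=
        (ofReal_integral_eq_lintegral_ofReal ig (.of_forall fun x =>
          (klFun_nonneg ENNReal.toReal_nonneg).trans (hle _ ENNReal.toReal_nonneg))).symm
    _ ≤ ENNReal.ofReal (Real.log c) := by
        refine ENNReal.ofReal_le_ofReal ?_
        have j1 := i1.mul_const (Real.log c)
        have j2 := i2.div_const c
        have j3 := i1.const_mul 2
        have e : ∫ x, (r x).toReal * Real.log c + (r x).toReal ^ 2 / c - 2 * (r x).toReal + 1 ∂μ
            = Real.log c + (∫ x, (r x).toReal ^ 2 ∂μ) / c - 2 + 1 := by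
          rw [integral_add (by exact (j1.add j2).sub j3) (integrable_const 1),
            integral_sub (by exact j1.add j2) j3, integral_add j1 j2, integral_mul_const,
            integral_div, integral_const_mul, e1]
          simp
        rw [e]
        have : (∫ x, (r x).toReal ^ 2 ∂μ) / c ≤ 1 := (div_le_one hc).2 e2
        linarith

lemma log_one_add_le_sqrt {x : ℝ} (hx : 0 ≤ x) : Real.log (1 + x) ≤ √x := by
  have h : 1 + x ≤ Real.exp √x := by
    -- The cubic term is needed: 1 + s + s²/2 alone falls below 1 + s² for s > 2.
    have h2 := Real.sum_le_exp_of_nonneg (Real.sqrt_nonneg x) 4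
    simp [Finset.sum_range_succ, Nat.factorial] at h2
    have h3 : √x ^ 2 = x := Real.sq_sqrt hx
    have := Real.sqrt_nonneg x
    nlinarith [mul_nonneg this (sq_nonneg (√x - 1)), mul_nonneg this (sq_nonneg (√x - 3/2))]
  rw [← Real.log_exp √x]
  exact Real.log_le_log (by linarith) h

lemma sqrt_add_le_sqrt_add_sqrt {x y : ℝ} (hx : 0 ≤ x) (hy : 0 ≤ y) : √(x + y) ≤ √x + √y := by
  refine Real.sqrt_le_iff.2 ⟨by positivity, ?_⟩
  nlinarith [Real.sq_sqrt hx, Real.sq_sqrt hy, mul_nonneg (Real.sqrt_nonneg x) (Real.sqrt_nonneg y)]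

/-! ### Integrals over y under the reference Gaussian -/

lemma lintegral_sq_gaussianReal (s : ℝ≥0) :
    ∫⁻ x, ENNReal.ofReal (x ^ 2) ∂(gaussianReal 0 s) = s := by
  have hm : MemLp (fun x : ℝ => x) 2 (gaussianReal 0 s) :=
    memLp_id_gaussianReal' (μ := 0) (v := s) 2 (by simp)
  rw [← ofReal_integral_eq_lintegral_ofReal hm.integrable_sq (.of_forall fun x => sq_nonneg x)]
  have := variance_eq_sub hm
  rw [variance_fun_id_gaussianReal, integral_id_gaussianReal] at this
  have h : ∫ x, x ^ 2 ∂(gaussianReal 0 s) = s := by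
    simpa using this.symm
  rw [h, ENNReal.ofReal_coe_nnreal]

/-- The root contributes (1 - b²)^(-1/4) and halves the exponent. The remaining Gaussian integral is
(1 + b)^(1/2), and the product simplifies. -/
lemma lintegral_sqrt_mehlerDiag {s : ℝ≥0} (hs : s ≠ 0) {b : ℝ} (hb0 : 0 < b) (hb : b < 1) :
    ∫⁻ y, ENNReal.ofReal √(mehlerDiag (y ^ 2 / s) b) ∂(gaussianReal 0 s) =
      ENNReal.ofReal (((1 + b) / (1 - b)) ^ (1 / 4 : ℝ)) := by
  have hs0 : (0 : ℝ) < s := by positivity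
  have h1 : 0 < 1 - b := by linarith
  have h2 : 0 < 1 - b ^ 2 := by nlinarith
  have e : ∀ y : ℝ, ENNReal.ofReal √(mehlerDiag (y ^ 2 / s) b) =
      ENNReal.ofReal (√(√(1 - b ^ 2))⁻¹) *
        ENNReal.ofReal (Real.exp (b / (2 * s * (1 + b)) * y ^ 2 + 0 * y)) := fun y => by
    rw [mehlerDiag, Real.sqrt_mul (by positivity), ← Real.exp_half,
      ← ENNReal.ofReal_mul (by positivity)]
    congr 3
    field_simp
    ring
  have hα : 1 - 2 * (b / (2 * s * (1 + b))) * s = (1 + b)⁻¹ := by field_simp; ring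
  simp_rw [e]
  rw [lintegral_const_mul _ (by fun_prop), lintegral_exp_quadratic_gaussianReal, hα,
    ← ENNReal.ofReal_mul (by positivity)]
  · congr 1
    have h4 : ((1 + b) / (1 - b)) ^ (1 / 4 : ℝ) = √√((1 + b) / (1 - b)) := by
      rw [Real.sqrt_eq_rpow, Real.sqrt_eq_rpow, ← Real.rpow_mul (by positivity)]
      norm_num
    rw [h4]
    have h5 : √(1 + b)⁻¹ = √√((1 + b)⁻¹ ^ 2) := by
      rw [Real.sqrt_sq (by positivity)]
    have h6 : (√(1 + b)⁻¹)⁻¹ = √√((1 + b) ^ 2) := by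
      rw [Real.sqrt_sq (by positivity), Real.sqrt_inv, inv_inv]
    rw [h6]
    simp only [ne_eq, OfNat.ofNat_ne_zero, not_false_eq_true, zero_pow, zero_mul, zero_div,
      Real.exp_zero, mul_one]
    rw [← Real.sqrt_mul (by positivity), ← Real.sqrt_inv, ← Real.sqrt_mul (by positivity)]
    congr 2
    rw [show 1 - b ^ 2 = (1 - b) * (1 + b) by ring]
    field_simp
  · have : 0 < 1 - 2 * (b / (2 * s * (1 + b))) * s := by rw [hα]; positivity
    linarith

lemma lintegral_isoGaussian_prod {k : ℕ} (s : ℝ≥0) {f : Fin k → ℝ → ℝ≥0∞}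
    (hf : ∀ i, Measurable (f i)) :
    ∫⁻ y, ∏ i, f i (y i) ∂(isoGaussian k s) = ∏ i, ∫⁻ x, f i x ∂(gaussianReal 0 s) := by
  rw [isoGaussian, lintegral_map (by fun_prop) (by fun_prop)]
  exact lintegral_prod_pi _ hf

lemma lintegral_isoGaussian_eval {k : ℕ} (s : ℝ≥0) {f : ℝ → ℝ≥0∞} (hf : Measurable f) (i : Fin k) :
    ∫⁻ y, f (y i) ∂(isoGaussian k s) = ∫⁻ x, f x ∂(gaussianReal 0 s) := by
  rw [isoGaussian, lintegral_map (by fun_prop) (by fun_prop)]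
  exact (measurePreserving_eval (fun _ : Fin k => gaussianReal 0 s) i).lintegral_comp hf

lemma lintegral_sqrt_sum_sq_isoGaussian_le {k : ℕ} (hk : 1 ≤ k) {s : ℝ≥0} (hs : s ≠ 0) :
    ∫⁻ y, ENNReal.ofReal √(∑ i, y i ^ 2 / s) ∂(isoGaussian k s) ≤ ENNReal.ofReal √k := by
  have hk0 : (0 : ℝ) < k := by exact_mod_cast hk
  have hs0 : (0 : ℝ) < s := by positivity
  -- Tangent line of the square root at k, the mean of |y|²/s; it replaces Jensen's inequality.
  have hle : ∀ z : ℝ, 0 ≤ z → √z ≤ (2 * √k)⁻¹ * z + √k / 2 := fun z hz => by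
    have h1 : √z ^ 2 = z := Real.sq_sqrt hz
    have h2 : √(k : ℝ) ^ 2 = k := Real.sq_sqrt hk0.le
    have h3 : 0 < √(k : ℝ) := by positivity
    have : (2 * √k)⁻¹ * z + √k / 2 - √z = (√z - √k) ^ 2 * (2 * √k)⁻¹ := by
      rw [sub_sq, h1]; field_simp; ring
    have : 0 ≤ (√z - √k) ^ 2 * (2 * √(k : ℝ))⁻¹ := by positivity
    linarith
  have hsum : ∫⁻ y, ENNReal.ofReal (∑ i, y i ^ 2 / s) ∂(isoGaussian k s) = ENNReal.ofReal k := by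
    have : ∀ y : EuclideanSpace ℝ (Fin k), ENNReal.ofReal (∑ i, y i ^ 2 / s)
        = ∑ i, ENNReal.ofReal ((s : ℝ)⁻¹) * ENNReal.ofReal (y i ^ 2) := fun y => by
      rw [ENNReal.ofReal_sum_of_nonneg fun i _ => by positivity]
      refine Finset.sum_congr rfl fun i _ => ?_
      rw [← ENNReal.ofReal_mul (by positivity)]
      congr 1; ring
    simp_rw [this]
    rw [lintegral_finsetSum _ fun i _ => by fun_prop]
    have h : ∀ i : Fin k, ∫⁻ y, ENNReal.ofReal ((s : ℝ)⁻¹) * ENNReal.ofReal (y i ^ 2)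
        ∂(isoGaussian k s) = 1 := fun i => by
      rw [lintegral_const_mul _ (by fun_prop),
        lintegral_isoGaussian_eval s (f := fun x => ENNReal.ofReal (x ^ 2)) (by fun_prop) i,
        lintegral_sq_gaussianReal, ← ENNReal.ofReal_coe_nnreal,
        ← ENNReal.ofReal_mul (by positivity), inv_mul_cancel₀ hs0.ne', ENNReal.ofReal_one]
    simp [h]
  calc ∫⁻ y, ENNReal.ofReal √(∑ i, y i ^ 2 / s) ∂(isoGaussian k s)
      ≤ ∫⁻ y, (ENNReal.ofReal (2 * √k)⁻¹ * ENNReal.ofReal (∑ i, y i ^ 2 / s)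
          + ENNReal.ofReal (√k / 2)) ∂(isoGaussian k s) := by
        refine lintegral_mono fun y => ?_
        rw [← ENNReal.ofReal_mul (by positivity), ← ENNReal.ofReal_add (by positivity)
          (by positivity)]
        exact ENNReal.ofReal_le_ofReal (hle _ (by positivity))
    _ = ENNReal.ofReal √k := by
        rw [lintegral_add_right _ (by fun_prop), lintegral_const_mul _ (by fun_prop), hsum,
          lintegral_const, measure_univ, mul_one, ← ENNReal.ofReal_mul (by positivity),
          ← ENNReal.ofReal_add (by positivity) (by positivity)]
        congr 1
        have h2 : √(k : ℝ) * √k = k := Real.mul_self_sqrt hk0.le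
        have h3 : 0 < √(k : ℝ) := by positivity
        field_simp
        linarith

lemma lintegral_sqrt_prod_mehlerDiag {k : ℕ} {s : ℝ≥0} (hs : s ≠ 0) {b : ℝ} (hb0 : 0 < b)
    (hb : b < 1) :
    ∫⁻ y, ENNReal.ofReal √(∏ i, mehlerDiag (y i ^ 2 / s) b) ∂(isoGaussian k s) =
      ENNReal.ofReal (((1 + b) / (1 - b)) ^ ((k : ℝ) / 4)) := by
  have hm : ∀ z, 0 ≤ mehlerDiag z b := fun z => by unfold mehlerDiag; positivity
  have e : ∀ y : EuclideanSpace ℝ (Fin k), ENNReal.ofReal √(∏ i, mehlerDiag (y i ^ 2 / s) b)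
      = ∏ i, ENNReal.ofReal √(mehlerDiag (y i ^ 2 / s) b) := fun y => by
    rw [← ENNReal.ofReal_prod_of_nonneg fun i _ => Real.sqrt_nonneg _, Real.sqrt_prod _ fun i _ => hm _]
  simp_rw [e]
  rw [lintegral_isoGaussian_prod s (f := fun _ x => ENNReal.ofReal √(mehlerDiag (x ^ 2 / s) b))
    (fun i => by unfold mehlerDiag; fun_prop)]
  have h1 : 0 < 1 - b := by linarith
  simp_rw [lintegral_sqrt_mehlerDiag hs hb0 hb, Finset.prod_const, Finset.card_univ,
    Fintype.card_fin, ← ENNReal.ofReal_pow (show 0 ≤ ((1 + b) / (1 - b)) ^ (1 / 4 : ℝ) by positivity)]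
  congr 1
  rw [← Real.rpow_natCast, ← Real.rpow_mul (by positivity)]
  congr 1; ring

/-! ### Expected entropy as an average over y, and the second moment of the density -/

section

variable {Ω : Type*} [MeasurableSpace Ω] {P : Measure Ω} [IsProbabilityMeasure P] {k n : ℕ}
  {X : Ω → EuclideanSpace ℝ (Fin n)} {Θ : Ω → Matrix (Fin k) (Fin n) ℝ}
  {N : Ω → EuclideanSpace ℝ (Fin k)}

/-- The function `klFun` is nonnegative on densities, unlike r log r, so the order of integration
can be exchanged without integrability. Having y outside lets the entropy bound act in Θ for fixed
y. -/
lemma expectedCondKL_projY (hX : Measurable X) (hΘ : Measurable Θ) (hN : Measurable N)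
    (hN_law : P.map N = stdGaussian (EuclideanSpace ℝ (Fin k)))
    (h_indep : IndepFun Θ X P) (h_indep_noise : IndepFun (fun ω => (Θ ω, X ω)) N P)
    {t s : ℝ≥0} (ht : t ≠ 0) (hs : s ≠ 0) :
    expectedCondKL (projY Θ X N t) Θ (isoGaussian k s) P =
      ∫⁻ y, ∫⁻ ω, ENNReal.ofReal (klFun (condDensity t s (P.map X) (Θ ω) y).toReal) ∂P
        ∂(isoGaussian k s) := by
  have := Measure.isProbabilityMeasure_map (μ := P) hX.aemeasurable
  have := isMarkovKernel_condKernelY (k := k) (P.map X) ht hs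
  have hae := ae_of_ae_map hΘ.aemeasurable
    (condDistrib_projY hX hΘ hN hN_law h_indep h_indep_noise ht hs)
  rw [expectedCondKL, lintegral_lintegral_swap]
  · refine lintegral_congr_ae ?_
    filter_upwards [hae] with ω hω
    have hr : Measurable (condDensity t s (P.map X) (Θ ω)) :=
      measurable_condDensity_comp _ _ _ measurable_const measurable_id
    have hac : condKernelY (P.map X) t s (Θ ω) ≪ isoGaussian k s := by
      rw [condKernelY_apply]
      exact withDensity_absolutelyContinuous _ _
    rw [hω, klDiv_eq_lintegral_klFun_of_ac hac, condKernelY_apply]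
    refine lintegral_congr_ae ?_
    filter_upwards [Measure.rnDeriv_withDensity (isoGaussian k s) hr] with y hy
    rw [hy]
  · have h := measurable_condDensity_comp (P.map X) t s (hΘ.comp measurable_snd)
      (measurable_fst (α := EuclideanSpace ℝ (Fin k)))
    exact (measurable_klFun.comp h.ennreal_toReal).ennreal_ofReal.aemeasurable

end

/-- The square of an average over X is an average over an independent pair; this is where X₁, X₂
appear. -/
lemma lintegral_sq_lintegral {α β : Type*} [MeasurableSpace α] [MeasurableSpace β]
    {P : Measure α} {μ : Measure β} [SFinite P] [SFinite μ] {F : α → β → ℝ≥0∞}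
    (hF : Measurable fun q : α × β => F q.1 q.2) :
    ∫⁻ ω, (∫⁻ x, F ω x ∂μ) ^ 2 ∂P = ∫⁻ p, ∫⁻ ω, F ω p.1 * F ω p.2 ∂P ∂(μ.prod μ) := by
  have hFx : ∀ ω, Measurable (F ω) := fun ω => hF.comp measurable_prodMk_left
  have h1 : Measurable fun q : α × β × β => F q.1 q.2.1 :=
    hF.comp (g := fun q : α × β => F q.1 q.2) (f := fun q : α × β × β => (q.1, q.2.1)) (by fun_prop)
  have h2 : Measurable fun q : α × β × β => F q.1 q.2.2 :=
    hF.comp (g := fun q : α × β => F q.1 q.2) (f := fun q : α × β × β => (q.1, q.2.2)) (by fun_prop)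
  rw [← lintegral_lintegral_swap (h1.mul h2).aemeasurable]
  refine lintegral_congr fun ω => ?_
  rw [lintegral_prod_mul (hFx ω).aemeasurable (hFx ω).aemeasurable, sq]

section

variable {n : ℕ} {μ : Measure (EuclideanSpace ℝ (Fin n))} [IsProbabilityMeasure μ] {γ : ℝ}

lemma integrable_id_of_ae_norm_sq (hn : n ≠ 0) (hμ : ∀ᵐ x ∂μ, ‖x‖ ^ 2 / (n : ℝ) = γ) :
    Integrable (fun x => x) μ := by
  refine Integrable.of_bound (by fun_prop) √(n * γ) ?_
  filter_upwards [hμ] with x hx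
  have hn' : (n : ℝ) ≠ 0 := by exact_mod_cast hn
  rw [← hx, mul_div_cancel₀ _ hn', Real.sqrt_sq (norm_nonneg x)]

lemma ae_prod_norm_sq {μ : Measure (EuclideanSpace ℝ (Fin n))} [SFinite μ]
    (hμ : ∀ᵐ x ∂μ, ‖x‖ ^ 2 / (n : ℝ) = γ) :
    ∀ᵐ p ∂(μ.prod μ), ‖p.1‖ ^ 2 / (n : ℝ) = γ ∧ ‖p.2‖ ^ 2 / (n : ℝ) = γ :=
  (Measure.quasiMeasurePreserving_fst.ae hμ).and (Measure.quasiMeasurePreserving_snd.ae hμ)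

lemma abs_inner_div_le (hn : n ≠ 0) {x x' : EuclideanSpace ℝ (Fin n)}
    (hx : ‖x‖ ^ 2 / (n : ℝ) = γ) (hx' : ‖x'‖ ^ 2 / (n : ℝ) = γ) :
    |inner ℝ x x' / n| ≤ γ := by
  have hn' : (0 : ℝ) < n := by positivity
  rw [abs_div, abs_of_pos hn', div_le_iff₀ hn']
  have := abs_real_inner_le_norm x x'
  rw [div_eq_iff hn'.ne'] at hx hx'
  nlinarith [sq_nonneg (‖x‖ - ‖x'‖)]

lemma integrable_inner_div (hn : n ≠ 0) (hμ : ∀ᵐ x ∂μ, ‖x‖ ^ 2 / (n : ℝ) = γ) :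
    Integrable (fun p : EuclideanSpace ℝ (Fin n) × EuclideanSpace ℝ (Fin n) =>
      inner ℝ p.1 p.2 / (n : ℝ)) (μ.prod μ) := by
  refine Integrable.of_bound (Measurable.aestronglyMeasurable (by fun_prop)) γ ?_
  filter_upwards [ae_prod_norm_sq hμ] with p hp
  exact abs_inner_div_le hn hp.1 hp.2

lemma integrable_inner_div_sq (hn : n ≠ 0) (hμ : ∀ᵐ x ∂μ, ‖x‖ ^ 2 / (n : ℝ) = γ) :
    Integrable (fun p : EuclideanSpace ℝ (Fin n) × EuclideanSpace ℝ (Fin n) =>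
      (inner ℝ p.1 p.2 / (n : ℝ)) ^ 2) (μ.prod μ) := by
  refine Integrable.of_bound (Measurable.aestronglyMeasurable (by fun_prop)) (γ ^ 2) ?_
  filter_upwards [ae_prod_norm_sq hμ] with p hp
  rw [norm_pow]
  have := abs_inner_div_le hn hp.1 hp.2
  gcongr
  exact this

lemma integral_inner_div (hn : n ≠ 0) (hμ : ∀ᵐ x ∂μ, ‖x‖ ^ 2 / (n : ℝ) = γ) :
    ∫ p, inner ℝ p.1 p.2 / (n : ℝ) ∂(μ.prod μ) = ‖∫ x, x ∂μ‖ ^ 2 / n := by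
  have hi := integrable_id_of_ae_norm_sq hn hμ
  rw [integral_prod _ (integrable_inner_div hn hμ)]
  simp_rw [integral_div]
  congr 1
  have h1 : ∀ x : EuclideanSpace ℝ (Fin n), ∫ y, inner ℝ x y ∂μ = inner ℝ x (∫ y, y ∂μ) :=
    fun x => integral_inner hi x
  simp_rw [h1, real_inner_comm (∫ y, y ∂μ)]
  rw [integral_inner hi, real_inner_self_eq_norm_sq]

variable {Ω : Type*} [MeasurableSpace Ω] {P : Measure Ω} [IsProbabilityMeasure P] {k : ℕ}
  {Θ : Ω → Matrix (Fin k) (Fin n) ℝ}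

lemma lintegral_condDensity_sq_le (hΘ : IsIIDGaussianProjection Θ P) (hn : n ≠ 0) {t : ℝ}
    (hγ : 0 < γ) (ht : 0 < t) (hμ : ∀ᵐ x ∂μ, ‖x‖ ^ 2 / (n : ℝ) = γ)
    (y : EuclideanSpace ℝ (Fin k)) :
    ∫⁻ ω, condDensity t (γ + t) μ (Θ ω) y ^ 2 ∂P ≤
      ENNReal.ofReal (1 + (‖∫ x, x ∂μ‖ ^ 2 / n / (γ + t) * (∑ i, y i ^ 2 / (γ + t)) +
        (∫ p, (inner ℝ p.1 p.2 / (n : ℝ)) ^ 2 ∂(μ.prod μ)) / γ ^ 2 *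
          ∏ i, mehlerDiag (y i ^ 2 / (γ + t)) (γ / (γ + t)))) := by
  have hs : 0 < γ + t := by linarith
  set F : Ω → EuclideanSpace ℝ (Fin n) → ℝ≥0∞ := fun ω x =>
    ∏ i, gaussianRatio t (γ + t) ((Θ ω *ᵥ x.ofLp) i) (y i) with hF
  have hFm : Measurable fun q : Ω × EuclideanSpace ℝ (Fin n) => F q.1 q.2 := by
    have h := (measurable_prod_gaussianRatio (k := k) (n := n) t (γ + t)).comp
      (((hΘ.measurable.comp measurable_fst).prodMk (measurable_const (a := y))).prodMk
        (measurable_snd (α := Ω)))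
    simpa only [Function.comp_def] using h
  have hsq : ∫⁻ ω, condDensity t (γ + t) μ (Θ ω) y ^ 2 ∂P
      = ∫⁻ p, ∫⁻ ω, F ω p.1 * F ω p.2 ∂P ∂(μ.prod μ) := lintegral_sq_lintegral hFm
  rw [hsq]
  have i1 := integrable_inner_div hn hμ
  have i2 := integrable_inner_div_sq hn hμ
  set z := ∑ i, y i ^ 2 / (γ + t) with hz
  set Q := ∏ i, mehlerDiag (y i ^ 2 / (γ + t)) (γ / (γ + t)) with hQ
  have ig : Integrable (fun p : EuclideanSpace ℝ (Fin n) × EuclideanSpace ℝ (Fin n) =>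
      1 + (inner ℝ p.1 p.2 / (n : ℝ) * (z / (γ + t)) +
        (inner ℝ p.1 p.2 / (n : ℝ)) ^ 2 * (Q / γ ^ 2))) (μ.prod μ) :=
    (integrable_const 1).add ((i1.mul_const _).add (i2.mul_const _))
  have key : ∀ᵐ p ∂(μ.prod μ), 0 ≤ 1 + (inner ℝ p.1 p.2 / (n : ℝ) * (z / (γ + t)) +
        (inner ℝ p.1 p.2 / (n : ℝ)) ^ 2 * (Q / γ ^ 2)) ∧ ∫⁻ ω, F ω p.1 * F ω p.2 ∂P ≤
      ENNReal.ofReal (1 + (inner ℝ p.1 p.2 / (n : ℝ) * (z / (γ + t)) +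
        (inner ℝ p.1 p.2 / (n : ℝ)) ^ 2 * (Q / γ ^ 2))) := by
    filter_upwards [ae_prod_norm_sq hμ] with p hp
    have hρ := abs_inner_div_le hn hp.1 hp.2
    have hin : (∑ j, p.1.ofLp j * p.2.ofLp j) / n = inner ℝ p.1 p.2 / (n : ℝ) := by
      simp [PiLp.inner_apply, mul_comm]
    have e := hΘ.lintegral_prod_gaussianRatio_mul hγ ht (x := p.1.ofLp) (x' := p.2.ofLp)
      (by rw [← EuclideanSpace.real_norm_sq_eq]; exact hp.1)
      (by rw [← EuclideanSpace.real_norm_sq_eq]; exact hp.2) hin hρ hn y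
    have hab : |inner ℝ p.1 p.2 / (n : ℝ) / (γ + t)| ≤ γ / (γ + t) := by
      rw [abs_div, abs_of_pos hs]
      gcongr
    -- Cauchy–Schwarz gives |ρ| ≤ γ, hence the radius b = γ/(γ + t), which is below 1 because t > 0.
    have hle := prod_mehlerDiag_le (z := fun i => y i ^ 2 / (γ + t)) (fun i => by positivity) hab
      (by positivity) ((div_lt_one hs).2 (by linarith))
    have e2 : 1 + inner ℝ p.1 p.2 / (n : ℝ) / (γ + t) * ∑ i, y i ^ 2 / (γ + t) +
        (inner ℝ p.1 p.2 / (n : ℝ) / (γ + t)) ^ 2 / (γ / (γ + t)) ^ 2 *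
          ∏ i, mehlerDiag (y i ^ 2 / (γ + t)) (γ / (γ + t)) =
        1 + (inner ℝ p.1 p.2 / (n : ℝ) * (z / (γ + t)) +
        (inner ℝ p.1 p.2 / (n : ℝ)) ^ 2 * (Q / γ ^ 2)) := by
      rw [← hz, ← hQ]
      field_simp
      ring
    rw [e2] at hle
    refine ⟨le_trans (Finset.prod_nonneg fun i _ => ?_) hle, ?_⟩
    · unfold mehlerDiag; positivity
    · rw [hF, e]
      exact ENNReal.ofReal_le_ofReal hle
  refine (lintegral_mono_ae (key.mono fun p hp => hp.2)).trans ?_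
  rw [← ofReal_integral_eq_lintegral_ofReal ig (key.mono fun p hp => hp.1),
    integral_add (integrable_const 1) (by exact (i1.mul_const _).add (i2.mul_const _)),
    integral_add (i1.mul_const _) (i2.mul_const _), integral_mul_const, integral_mul_const,
    integral_inner_div hn hμ]
  refine ENNReal.ofReal_le_ofReal (le_of_eq ?_)
  simp only [integral_const, probReal_univ, smul_eq_mul, mul_one]
  ring

end

/-! ### Assembling the bound -/

/-- The main estimate, with the dimensional constants `k ^ (3 / 4)` and `k ^ (1 / 4)` improved to
`k ^ (1 / 2)` and `1`. -/
lemma expectedCondKL_projY_le {Ω : Type*} [MeasurableSpace Ω] {P : Measure Ω}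
    [IsProbabilityMeasure P] {k n : ℕ} (hk : 1 ≤ k) (hn : n ≠ 0) {γ t : ℝ≥0} (hγ : γ ≠ 0)
    (ht : t ≠ 0) {X : Ω → EuclideanSpace ℝ (Fin n)} {Θ : Ω → Matrix (Fin k) (Fin n) ℝ}
    {N : Ω → EuclideanSpace ℝ (Fin k)}
    (hX : Measurable X) (hΘ : IsIIDGaussianProjection Θ P)
    (hN : Measurable N) (hN_law : P.map N = stdGaussian (EuclideanSpace ℝ (Fin k)))
    (h_indep : IndepFun Θ X P) (h_indep_noise : IndepFun (fun ω => (Θ ω, X ω)) N P)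
    (h_sphere : ∀ᵐ x ∂(P.map X), ‖x‖ ^ 2 / (n : ℝ) = γ) :
    expectedCondKL (projY Θ X N t) Θ (gaussianApprox (projY Θ X N t) P) P ≤
      ENNReal.ofReal (√(‖∫ x, x ∂(P.map X)‖ ^ 2 / n / (γ + t)) * √k +
        √((∫ p, (inner ℝ p.1 p.2 / (n : ℝ)) ^ 2 ∂((P.map X).prod (P.map X))) / γ ^ 2) *
          (1 + 2 * γ / t : ℝ) ^ ((k : ℝ) / 4)) := by
  have := Measure.isProbabilityMeasure_map (μ := P) hX.aemeasurable
  have hγ0 : (0 : ℝ) < γ := by positivity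
  have ht0 : (0 : ℝ) < t := by positivity
  have hs0 : (0 : ℝ) < γ + t := by positivity
  have hs : γ + t ≠ 0 := by positivity
  have h_sphere' : ∀ᵐ x ∂(P.map X), (∑ j, x.ofLp j ^ 2) / n = (γ : ℝ) := by
    filter_upwards [h_sphere] with x hx
    rw [← EuclideanSpace.real_norm_sq_eq, hx]
  rw [gaussianApprox_of_map_eq (measurable_projY hX hΘ.measurable hN t)
    (map_projY hX hΘ hN hN_law h_indep h_indep_noise hγ ht h_sphere'),
    expectedCondKL_projY hX hΘ.measurable hN hN_law h_indep h_indep_noise ht hs]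
  set A : ℝ := ‖∫ x, x ∂(P.map X)‖ ^ 2 / n / (γ + t)
  set B : ℝ := (∫ p, (inner ℝ p.1 p.2 / (n : ℝ)) ^ 2 ∂((P.map X).prod (P.map X))) / γ ^ 2
  have hA : 0 ≤ A := by positivity
  have hB : 0 ≤ B := by positivity
  set z : EuclideanSpace ℝ (Fin k) → ℝ := fun y => ∑ i, y i ^ 2 / ((γ + t : ℝ≥0) : ℝ)
  set Q : EuclideanSpace ℝ (Fin k) → ℝ := fun y =>
    ∏ i, mehlerDiag (y i ^ 2 / ((γ + t : ℝ≥0) : ℝ)) (γ / (γ + t)) with hQ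
  have hz : ∀ y, 0 ≤ z y := fun y => by positivity
  have hQ0 : ∀ y, 0 ≤ Q y := fun y =>
    Finset.prod_nonneg fun i _ => by unfold mehlerDiag; positivity
  have hQm : Measurable Q := by simp only [hQ]; unfold mehlerDiag; fun_prop
  calc _ ≤ ∫⁻ y, (ENNReal.ofReal √A * ENNReal.ofReal √(z y)
          + ENNReal.ofReal √B * ENNReal.ofReal √(Q y)) ∂(isoGaussian k (γ + t)) := by
        refine lintegral_mono fun y => ?_
        have hAz : 0 ≤ A * z y := mul_nonneg hA (hz y)
        have hBQ : 0 ≤ B * Q y := mul_nonneg hB (hQ0 y)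
        have h1 := lintegral_condDensity_comp hΘ (P.map X) hγ0 ht0 h_sphere' y
        have h2 := lintegral_condDensity_sq_le hΘ hn hγ0 ht0 h_sphere y
        refine (lintegral_klFun_le_log P (c := 1 + (A * z y + B * Q y))
          (measurable_condDensity_comp _ _ _ hΘ.measurable measurable_const)
          (by simpa only [NNReal.coe_add] using h1) (by positivity)
          (by simp only [z, Q, NNReal.coe_add]; exact h2)).trans ?_
        rw [← ENNReal.ofReal_mul (Real.sqrt_nonneg _), ← ENNReal.ofReal_mul (Real.sqrt_nonneg _),
          ← ENNReal.ofReal_add (by positivity) (by positivity), ← Real.sqrt_mul hA,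
          ← Real.sqrt_mul hB]
        exact ENNReal.ofReal_le_ofReal
          ((log_one_add_le_sqrt (by positivity)).trans (sqrt_add_le_sqrt_add_sqrt hAz hBQ))
    _ ≤ ENNReal.ofReal √A * ENNReal.ofReal √k +
          ENNReal.ofReal √B * ENNReal.ofReal ((1 + 2 * γ / t : ℝ) ^ ((k : ℝ) / 4)) := by
        rw [lintegral_add_left (by fun_prop), lintegral_const_mul _ (by fun_prop),
          lintegral_const_mul _ (by fun_prop)]
        gcongr
        · exact lintegral_sqrt_sum_sq_isoGaussian_le hk hs
        · rw [lintegral_sqrt_prod_mehlerDiag hs (by positivity)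
            ((div_lt_one hs0).2 (by linarith))]
          have e : (1 + (γ / (γ + t) : ℝ)) / (1 - γ / (γ + t)) = 1 + 2 * γ / t := by
            have : 1 - (γ / (γ + t) : ℝ) = t / (γ + t) := by field_simp; ring
            rw [this]
            field_simp
            ring
          rw [e]
    _ = _ := by
        rw [← ENNReal.ofReal_mul (Real.sqrt_nonneg _), ← ENNReal.ofReal_mul (Real.sqrt_nonneg _),
          ← ENNReal.ofReal_add (by positivity) (by positivity)]

end

theorem theorem4 {Ω : Type*} [MeasurableSpace Ω] (P : Measure Ω) [IsProbabilityMeasure P]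
    (k n : ℕ) (hk : 1 ≤ k) (hn : 1 ≤ n) (γ t : ℝ) (hγ : 0 < γ) (ht : 0 < t)
    (X : Ω → EuclideanSpace ℝ (Fin n)) (Θ : Ω → Matrix (Fin k) (Fin n) ℝ)
    (N : Ω → EuclideanSpace ℝ (Fin k))
    (hX : Measurable X) (hΘ : IsIIDGaussianProjection Θ P)
    (hN : Measurable N) (hN_law : P.map N = stdGaussian (EuclideanSpace ℝ (Fin k)))
    (h_indep : IndepFun Θ X P) (h_indep_noise : IndepFun (fun ω => (Θ ω, X ω)) N P)
    (h_sphere : ∀ᵐ ω ∂P, ‖X ω‖ ^ 2 / (n : ℝ) = γ) :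
    expectedCondKL (projY Θ X N t) Θ (gaussianApprox (projY Θ X N t) P) P ≤
      ENNReal.ofReal
        ((k : ℝ) ^ (3 / 4 : ℝ) * (((1 / (n : ℝ)) * ‖∫ ω, X ω ∂P‖ ^ 2) / γ) ^ (1 / 2 : ℝ) +
          (k : ℝ) ^ (1 / 4 : ℝ) * (1 + 2 * γ / t) ^ ((k : ℝ) / 4) * (betaFun 2 X P / γ)) := by
  have hk1 : (1 : ℝ) ≤ k := by exact_mod_cast hk
  have hn0 : (0 : ℝ) < n := by exact_mod_cast hn
  lift γ to ℝ≥0 using hγ.le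
  lift t to ℝ≥0 using ht.le
  have h_sphere' : ∀ᵐ x ∂(P.map X), ‖x‖ ^ 2 / (n : ℝ) = γ :=
    (ae_map_iff hX.aemeasurable (measurableSet_eq_fun (by fun_prop) (by fun_prop))).2 h_sphere
  refine (expectedCondKL_projY_le hk (by omega) (by simpa using hγ.ne') (by simpa using ht.ne')
    hX hΘ hN hN_law h_indep h_indep_noise h_sphere').trans (ENNReal.ofReal_le_ofReal ?_)
  -- Only weakening remains: √k ≤ k^(3/4) and 1/(γ + t) ≤ 1/γ in the first term, 1 ≤ k^(1/4) in the
  -- second.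
  refine add_le_add ?_ ?_
  · rw [integral_map hX.aemeasurable (by fun_prop), mul_comm, ← Real.sqrt_eq_rpow,
      one_div_mul_eq_div]
    refine mul_le_mul ?_ (Real.sqrt_le_sqrt ?_) (Real.sqrt_nonneg _) (by positivity)
    · rw [Real.sqrt_eq_rpow]
      exact Real.rpow_le_rpow_of_exponent_le hk1 (by norm_num)
    · gcongr
      linarith
  · have hβ : √((∫ p, (inner ℝ p.1 p.2 / (n : ℝ)) ^ 2 ∂((P.map X).prod (P.map X))) / (γ : ℝ) ^ 2)
        = betaFun 2 X P / γ := by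
      rw [betaFun, Real.sqrt_div' _ (by positivity), Real.sqrt_sq hγ.le]
      congr 1
      simp_rw [sq_abs, div_pow]
      rw [integral_div, Real.sqrt_div' _ (by positivity), Real.sqrt_sq hn0.le, Nat.cast_ofNat,
        ← Real.sqrt_eq_rpow]
      ring
    rw [hβ, mul_comm]
    have hβ0 : 0 ≤ betaFun 2 X P / γ := hβ ▸ Real.sqrt_nonneg _
    have h1 : (1 : ℝ) ≤ (k : ℝ) ^ (1 / 4 : ℝ) := Real.one_le_rpow hk1 (by norm_num)
    have h2 : 0 ≤ (1 + 2 * (γ : ℝ) / t) ^ ((k : ℝ) / 4) := by positivity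
    exact mul_le_mul_of_nonneg_right (le_mul_of_one_le_left h2 h1) hβ0
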